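/- Let $M$ be a connected, complete smooth Riemannian manifold without boundary, with metric $\langle\cdot,\cdot\rangle$, $m=\dim M$, and let integrals and "a.e." refer to the Riemannian volume measure. Let $p\in(1,+\infty)$, $p'=\frac{p}{p-1}$, $\lambda>0$ and $k>0$. Let $A$ assign to each $x\in M$, $s\in\mathbb R$, $\xi\in T_xM$ a vector $A(x,s,\xi)\in T_xM$, such that in every local chart $\psi:U\subseteq M\to\mathbb R^m$ the local representation $\tilde A:\psi(U)\times\mathbb R\times\mathbb R^m\to\mathbb R^m$ of $A$ satisfies the Carathéodory conditions: $\tilde A(y,\cdot,\cdot)$ is continuous for a.e. $y\in\psi(U)$, and $\tilde A(\cdot,s,v)$ is measurable for every $(s,v)$. Suppose that $Lu=\operatorname{div}A(x,u,\nabla u)$ is weakly-$p$-coercive with coercivity constant $k$, that is, $$\langle A(x,s,\xi),\xi\rangle\ge 0\quad\text{and}\quad |A(x,s,\xi)|\le k\,\langle A(x,s,\xi),\xi\rangle^{\frac{p-1}{p}}\qquad\text{for all }x\in M,\ s\in\mathbb R,\ \xi\in T_xM.$$ Let $u\in W^{1,p}_{\mathrm{loc}}(M)$ be a weak solution of $Lu=\lambda|u|^{p-2}u$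 on $M$, that is, $$-\int_M\langle A(x,u,\nabla u),\nabla\varphi\rangle=\int_M\lambda|u|^{p-2}u\,\varphi\qquad\text{for all }\varphi\in W^{1,p}_{\mathrm{loc}}(M)\text{ with compact support}.$$ If for some $x_0\in M$, some $q\in(p-1,+\infty)$ and some $$C<\frac{p\,(q-p+1)^{1/p'}}{(p-1)^{1/p'}}\,\frac{\lambda^{1/p}}{k}$$ one has $$\int_{B_R(x_0)}|u|^q\le e^{CR}\qquad\text{for all sufficiently large }R,$$ then $u=0$ a.e. on $M$. -/

import Mathlib

open Set Filter Topology MeasureTheory Bundle Manifold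
open scoped ENNReal ContDiff InnerProductSpace

noncomputable section

namespace RiemannianLiouville

variable {m : ℕ} {M : Type*} [TopologicalSpace M] [ChartedSpace (EuclideanSpace ℝ (Fin m)) M]

/-- The tangent vector of `M` at `e.symm y` whose components in the coordinates of the chart `e`
are the entries of `v`, that is `∑ i, v i • ∂/∂yⁱ`. -/
def coordVector (e : OpenPartialHomeomorph M (EuclideanSpace ℝ (Fin m)))
    (y v : EuclideanSpace ℝ (Fin m)) : TangentSpace (𝓡 m) (e.symm y) :=
  mfderiv (𝓡 m) (𝓡 m) e.symm y v

/-- The components, in the coordinates of the chart `e`, of a tangent vector at `e.symm y`. -/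
def chartComponents (e : OpenPartialHomeomorph M (EuclideanSpace ℝ (Fin m)))
    (y : EuclideanSpace ℝ (Fin m)) (ξ : TangentSpace (𝓡 m) (e.symm y)) :
    EuclideanSpace ℝ (Fin m) :=
  mfderiv (𝓡 m) (𝓡 m) e (e.symm y) ξ

/-- The local representation of `A` in the chart `e`. -/
def localRep (A : (x : M) → ℝ → TangentSpace (𝓡 m) x → TangentSpace (𝓡 m) x)
    (e : OpenPartialHomeomorph M (EuclideanSpace ℝ (Fin m)))
    (y : EuclideanSpace ℝ (Fin m)) (s : ℝ) (v : EuclideanSpace ℝ (Fin m)) :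
    EuclideanSpace ℝ (Fin m) :=
  chartComponents e y (A (e.symm y) s (coordVector e y v))

/-- The Carathéodory conditions, in every chart of the smooth structure. Measurability is with
respect to the Lebesgue σ-algebra. -/
structure IsCaratheodory
    (A : (x : M) → ℝ → TangentSpace (𝓡 m) x → TangentSpace (𝓡 m) x) : Prop where
  continuous : ∀ e ∈ IsManifold.maximalAtlas (𝓡 m) ∞ M,
    ∀ᵐ y ∂(volume.restrict e.target),
      Continuous fun z : ℝ × EuclideanSpace ℝ (Fin m) => localRep A e y z.1 z.2
  measurable : ∀ e ∈ IsManifold.maximalAtlas (𝓡 m) ∞ M,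
    ∀ (s : ℝ) (v : EuclideanSpace ℝ (Fin m)),
      AEMeasurable (fun y => localRep A e y s v) (volume.restrict e.target)

variable [RiemannianBundle (fun x : M => TangentSpace (𝓡 m) x)]

/-- The matrix `g_ij = ⟨∂/∂yⁱ, ∂/∂yʲ⟩` of the Riemannian metric in the chart `e`. -/
def gramMatrix (e : OpenPartialHomeomorph M (EuclideanSpace ℝ (Fin m)))
    (y : EuclideanSpace ℝ (Fin m)) : Matrix (Fin m) (Fin m) ℝ :=
  Matrix.of fun i j =>
    ⟪coordVector e y (EuclideanSpace.single i 1), coordVector e y (EuclideanSpace.single j 1)⟫_ℝ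

/-- `L u = div A(x, u, ∇u)` is weakly-`p`-coercive with coercivity constant `k`. -/
structure IsWeaklyCoercive (p k : ℝ)
    (A : (x : M) → ℝ → TangentSpace (𝓡 m) x → TangentSpace (𝓡 m) x) : Prop where
  caratheodory : IsCaratheodory A
  inner_nonneg : ∀ (x : M) (s : ℝ) (ξ : TangentSpace (𝓡 m) x), 0 ≤ ⟪A x s ξ, ξ⟫_ℝ
  norm_le : ∀ (x : M) (s : ℝ) (ξ : TangentSpace (𝓡 m) x),
    ‖A x s ξ‖ ≤ k * ⟪A x s ξ, ξ⟫_ℝ ^ ((p - 1) / p)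

/-- The vector field `X` is a weak gradient of `u`: in every chart, the components
`⟨X, ∂/∂yⁱ⟩` are the weak partial derivatives of `u`. -/
structure IsWeakGradient (u : M → ℝ) (X : (x : M) → TangentSpace (𝓡 m) x) : Prop where
  locallyIntegrable : ∀ e ∈ IsManifold.maximalAtlas (𝓡 m) ∞ M,
    LocallyIntegrableOn (fun y => u (e.symm y)) e.target volume
  locallyIntegrable_grad : ∀ e ∈ IsManifold.maximalAtlas (𝓡 m) ∞ M,
    ∀ v : EuclideanSpace ℝ (Fin m),
      LocallyIntegrableOn (fun y => ⟪X (e.symm y), coordVector e y v⟫_ℝ) e.target volume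
  integral_eq : ∀ e ∈ IsManifold.maximalAtlas (𝓡 m) ∞ M,
    ∀ (v : EuclideanSpace ℝ (Fin m)) (ζ : EuclideanSpace ℝ (Fin m) → ℝ),
      ContDiff ℝ ∞ ζ → HasCompactSupport ζ → tsupport ζ ⊆ e.target →
        ∫ y in e.target, u (e.symm y) * fderiv ℝ ζ y v =
          -∫ y in e.target, ⟪X (e.symm y), coordVector e y v⟫_ℝ * ζ y

variable [MeasurableSpace M]

/-- The Riemannian volume of the domain of the chart `e`: the measure with density
`√(det g_ij)` with respect to Lebesgue measure in the coordinates of `e`. -/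
def chartVolume (e : OpenPartialHomeomorph M (EuclideanSpace ℝ (Fin m))) : Measure M :=
  ((volume.restrict e.target).withDensity
    fun y => ENNReal.ofReal √(gramMatrix e y).det).map e.symm

variable (m M) in
/-- The Riemannian volume measure of `M`. The measures `chartVolume e` and `chartVolume e'` agree
on the intersection of the domains of `e` and `e'`, so that the least measure above all of them is
the measure whose restriction to the domain of each chart `e` is `chartVolume e`. -/
def riemannianVolume : Measure M :=
  ⨆ e ∈ IsManifold.maximalAtlas (𝓡 m) ∞ M, chartVolume e

/-- `u` belongs to `W^{1,p}_loc(M)` and its weak gradient is `X`. -/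
structure HasSobolevGradient (p : ℝ) (u : M → ℝ) (X : (x : M) → TangentSpace (𝓡 m) x) :
    Prop where
  isWeakGradient : IsWeakGradient u X
  memLp : ∀ K : Set M, IsCompact K →
    MemLp u (ENNReal.ofReal p) ((riemannianVolume m M).restrict K)
  memLp_grad : ∀ K : Set M, IsCompact K →
    MemLp (fun x => ‖X x‖) (ENNReal.ofReal p) ((riemannianVolume m M).restrict K)

variable (m) in
/-- The space `W^{1,p}_loc(M)`. -/
def MemSobolevLoc (p : ℝ) (u : M → ℝ) : Prop :=
  ∃ X : (x : M) → TangentSpace (𝓡 m) x, HasSobolevGradient p u X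

/-- `u ∈ W^{1,p}_loc(M)` is a weak solution of `div A(x, u, ∇u) = f` on `M`; the test functions
are the compactly supported elements `φ` of `W^{1,p}_loc(M)`, with weak gradient `Y`. -/
def IsWeakSolution (p : ℝ) (A : (x : M) → ℝ → TangentSpace (𝓡 m) x → TangentSpace (𝓡 m) x)
    (f u : M → ℝ) : Prop :=
  ∃ X : (x : M) → TangentSpace (𝓡 m) x, HasSobolevGradient p u X ∧
    ∀ (φ : M → ℝ) (Y : (x : M) → TangentSpace (𝓡 m) x),
      HasSobolevGradient p φ Y → HasCompactSupport φ →
        -∫ x, ⟪A x (u x) (X x), Y x⟫_ℝ ∂(riemannianVolume m M) =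
          ∫ x, f x * φ x ∂(riemannianVolume m M)

end RiemannianLiouville

end

/-!
Fix `c` above `C` but below the critical constant, and test the equation with
`u β_δ(u) η^p`, where `β_δ(u)` is a truncation of `|u|^(q - p)` and, for the distance `r` to `x₀`,
`η = (e^(-c r / p) - e^(-c R / p))₊`. Since `|∇η| ≤ (c / p) e^(-c r / p)`, weak coercivity and
Young's inequality absorb every term containing `∇u`, at the price of `κ |u|^q e^(-c r)`. Letting
`δ → 0` gives `∫_{B_R} |u|^q (η^p - κ e^(-c r)) ≤ 0`, with `κ < 1` exactly because `c` is
subcritical. As `e^(-c r)` is at most a multiple close to one of `η^p` plus a multiple of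
`e^(-c R)`, the growth bound `e^(C R)` with `C < c` forces `∫ |u|^q η^p` to vanish as `R → ∞`.
Completeness enters through Hopf–Rinow, which makes the balls relatively compact, so that the test
functions are admissible. For the chain and product rules `u` is mollified in charts.
-/

noncomputable section

open scoped Convolution NNReal

namespace RiemannianLiouville

section HopfRinow

/-- Points can be interpolated with arbitrarily small loss: a weak form of being a length space
which is enough for the Hopf–Rinow theorem. -/
def HasApproximateInterpolation (α : Type*) [PseudoMetricSpace α] : Prop :=
  ∀ ⦃x y : α⦄ ⦃a b : ℝ⦄, 0 ≤ a → 0 < b → dist x y < a + b → ∃ z, dist x z ≤ a ∧ dist z y < b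

variable {α : Type*} [PseudoMetricSpace α]

theorem HasApproximateInterpolation.isCompact_closedBall_of_forall_lt [CompleteSpace α]
    (H : HasApproximateInterpolation α) {x : α} {R : ℝ}
    (hR : ∀ s < R, IsCompact (Metric.closedBall x s)) : IsCompact (Metric.closedBall x R) := by
  refine isCompact_iff_totallyBounded_isComplete.2 ⟨?_, Metric.isClosed_closedBall.isComplete⟩
  rw [Metric.totallyBounded_iff]
  intro ε hε
  rcases lt_or_ge R ε with hRε | hRε
  · exact ⟨{x}, finite_singleton x, by simpa using Metric.closedBall_subset_ball hRε⟩
  obtain ⟨t, t_finite, ht⟩ := Metric.totallyBounded_iff.1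
    (hR (R - ε / 4) (by linarith)).totallyBounded (ε / 2) (by linarith)
  refine ⟨t, t_finite, fun y hy => ?_⟩
  obtain ⟨z, hxz, hzy⟩ := H (x := x) (y := y) (a := R - ε / 4) (b := ε / 2) (by linarith)
    (by linarith) (by linarith [Metric.mem_closedBall'.1 hy])
  obtain ⟨w, hw, hzw⟩ := mem_iUnion₂.1 (ht (Metric.mem_closedBall'.2 hxz))
  refine mem_iUnion₂.2 ⟨w, hw, ?_⟩
  rw [Metric.mem_ball] at hzw ⊢
  linarith [dist_triangle_left y w z]

theorem HasApproximateInterpolation.exists_isCompact_closedBall_add [LocallyCompactSpace α]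
    (H : HasApproximateInterpolation α) {x : α} {R : ℝ} (hR : 0 ≤ R)
    (hcompact : IsCompact (Metric.closedBall x R)) :
    ∃ δ > 0, IsCompact (Metric.closedBall x (R + δ)) := by
  obtain ⟨δ, hδ, hthick⟩ := hcompact.exists_isCompact_cthickening
  refine ⟨δ / 2, half_pos hδ,
    hthick.of_isClosed_subset Metric.isClosed_closedBall fun y hy => ?_⟩
  obtain ⟨z, hxz, hzy⟩ := H hR hδ (by linarith [Metric.mem_closedBall'.1 hy])
  exact Metric.mem_cthickening_of_dist_le y z δ _ (Metric.mem_closedBall'.2 hxz)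
    (by rw [dist_comm]; exact hzy.le)

theorem HasApproximateInterpolation.properSpace [CompleteSpace α] [LocallyCompactSpace α]
    (H : HasApproximateInterpolation α) : ProperSpace α := by
  refine ⟨fun x r => ?_⟩
  by_contra hr
  set T : Set ℝ := {s | ¬IsCompact (Metric.closedBall x s)}
  have nonneg_of_mem : ∀ s ∈ T, 0 ≤ s := fun s hs => by
    by_contra! h
    exact hs (by simp [Metric.closedBall_eq_empty.2 h])
  have compact_sInf : IsCompact (Metric.closedBall x (sInf T)) :=
    H.isCompact_closedBall_of_forall_lt fun s hs => by
      simpa [T] using notMem_of_lt_csInf hs ⟨0, nonneg_of_mem⟩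
  obtain ⟨δ, hδ, compact_add⟩ :=
    H.exists_isCompact_closedBall_add (le_csInf ⟨r, hr⟩ nonneg_of_mem) compact_sInf
  obtain ⟨s, hs, hlt⟩ := exists_lt_of_csInf_lt ⟨r, hr⟩ (lt_add_of_pos_right (sInf T) hδ)
  exact hs (compact_add.of_isClosed_subset Metric.isClosed_closedBall
    (Metric.closedBall_subset_closedBall hlt.le))

variable {m : ℕ} {M : Type*} [MetricSpace M] [ChartedSpace (EuclideanSpace ℝ (Fin m)) M]
  [RiemannianBundle (fun x : M => TangentSpace (𝓡 m) x)]

variable (m M) in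
theorem hasApproximateInterpolation_of_isRiemannianManifold [IsRiemannianManifold (𝓡 m) M] :
    HasApproximateInterpolation M := by
  intro x y a b ha hb hxy
  rcases le_total (dist x y) a with h | h
  · exact ⟨y, h, by simpa using hb⟩
  have hlt : riemannianEDist (𝓡 m) x y < ENNReal.ofReal (a + b) := by
    rw [← IsRiemannianManifold.out (I := 𝓡 m) x y, edist_dist]
    exact (ENNReal.ofReal_lt_ofReal_iff (by linarith)).2 hxy
  obtain ⟨γ, hγ0, hγ1, hγ, hlength⟩ := exists_lt_of_riemannianEDist_lt hlt
  have hcont : ContinuousOn (fun t => dist x (γ t)) (Icc 0 1) :=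
    (continuous_const.dist continuous_id).comp_continuousOn hγ.continuousOn
  obtain ⟨t, ht, hta : dist x (γ t) = a⟩ := intermediate_value_Icc zero_le_one hcont
    (show a ∈ Icc (dist x (γ 0)) (dist x (γ 1)) by simp [hγ0, hγ1, ha, h])
  refine ⟨γ t, hta.le, ?_⟩
  have hleft : edist x (γ t) ≤ pathELength (𝓡 m) γ 0 t := by
    rw [IsRiemannianManifold.out (I := 𝓡 m)]
    exact riemannianEDist_le_pathELength (hγ.mono (Icc_subset_Icc_right ht.2)) hγ0 rfl ht.1
  have hright : edist (γ t) y ≤ pathELength (𝓡 m) γ t 1 := by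
    rw [IsRiemannianManifold.out (I := 𝓡 m)]
    exact riemannianEDist_le_pathELength (hγ.mono (Icc_subset_Icc_left ht.1)) rfl hγ1 ht.2
  have hsum : edist x (γ t) + edist (γ t) y < ENNReal.ofReal (a + b) := by
    refine (add_le_add hleft hright).trans_lt ?_
    rwa [pathELength_add ht.1 ht.2]
  rw [edist_dist, edist_dist, hta, ← ENNReal.ofReal_add ha dist_nonneg,
    ENNReal.ofReal_lt_ofReal_iff (by linarith)] at hsum
  linarith

variable (m M) in
theorem properSpace_of_completeSpace [IsRiemannianManifold (𝓡 m) M] [CompleteSpace M] :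
    ProperSpace M := by
  have : LocallyCompactSpace M := Manifold.locallyCompact_of_finiteDimensional (𝓡 m)
  exact (hasApproximateInterpolation_of_isRiemannianManifold m M).properSpace

end HopfRinow

section Charts

variable {m : ℕ} {M : Type*} [TopologicalSpace M] [ChartedSpace (EuclideanSpace ℝ (Fin m)) M]
  {e : OpenPartialHomeomorph M (EuclideanSpace ℝ (Fin m))}

theorem mdifferentiable_of_mem_maximalAtlas (he : e ∈ IsManifold.maximalAtlas (𝓡 m) ∞ M) :
    e.MDifferentiable (𝓡 m) (𝓡 m) :=
  ⟨(contMDiffOn_of_mem_maximalAtlas he).mdifferentiableOn (by simp),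
    (contMDiffOn_symm_of_mem_maximalAtlas he).mdifferentiableOn (by simp)⟩

theorem coordVector_zero (y : EuclideanSpace ℝ (Fin m)) : coordVector e y 0 = 0 :=
  map_zero (mfderiv (𝓡 m) (𝓡 m) e.symm y)

theorem coordVector_smul (y : EuclideanSpace ℝ (Fin m)) (t : ℝ) (v : EuclideanSpace ℝ (Fin m)) :
    coordVector e y (t • v) = t • coordVector e y v :=
  map_smul (mfderiv (𝓡 m) (𝓡 m) e.symm y) t v

theorem coordVector_eq_sum (e : OpenPartialHomeomorph M (EuclideanSpace ℝ (Fin m)))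
    (y v : EuclideanSpace ℝ (Fin m)) :
    coordVector e y v = ∑ i, v i • coordVector e y (EuclideanSpace.single i 1) := by
  have h : v = ∑ i, v i • EuclideanSpace.single i (1 : ℝ) := by
    ext j
    simp [Finset.sum_apply, Pi.single_apply]
  conv_lhs => rw [h]
  exact (map_sum (mfderiv (𝓡 m) (𝓡 m) e.symm y) _ _).trans
    (Finset.sum_congr rfl fun i _ => coordVector_smul y (v i) _)

theorem chartComponents_coordVector (he : e ∈ IsManifold.maximalAtlas (𝓡 m) ∞ M)
    {y : EuclideanSpace ℝ (Fin m)} (hy : y ∈ e.target) (v : EuclideanSpace ℝ (Fin m)) :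
    chartComponents e y (coordVector e y v) = v :=
  DFunLike.congr_fun ((mdifferentiable_of_mem_maximalAtlas he).comp_symm_deriv hy) v

theorem coordVector_chartComponents (he : e ∈ IsManifold.maximalAtlas (𝓡 m) ∞ M)
    {y : EuclideanSpace ℝ (Fin m)} (hy : y ∈ e.target) (ξ : TangentSpace (𝓡 m) (e.symm y)) :
    coordVector e y (chartComponents e y ξ) = ξ := by
  have h := (mdifferentiable_of_mem_maximalAtlas he).symm_comp_deriv (e.map_target hy)
  rw [e.right_inv hy] at h
  exact DFunLike.congr_fun h ξ

theorem continuousOn_coordVector [IsManifold (𝓡 m) ∞ M]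
    (he : e ∈ IsManifold.maximalAtlas (𝓡 m) ∞ M) :
    ContinuousOn (fun z : EuclideanSpace ℝ (Fin m) × EuclideanSpace ℝ (Fin m) =>
      (TotalSpace.mk (e.symm z.1) (coordVector e z.1 z.2) : TangentBundle (𝓡 m) M))
      (e.target ×ˢ univ) := by
  have h1 := (contMDiffOn_symm_of_mem_maximalAtlas he).continuousOn_tangentMapWithin
    (by simp) e.open_target.uniqueMDiffOn
  have h2 : Continuous fun z : EuclideanSpace ℝ (Fin m) × EuclideanSpace ℝ (Fin m) =>
      (TotalSpace.mk z.1 z.2 : TangentBundle (𝓡 m) (EuclideanSpace ℝ (Fin m))) :=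
    (tangentBundleModelSpaceHomeomorph (𝓡 m)).symm.continuous
  refine (h1.comp h2.continuousOn (fun z hz => hz.1)).congr fun z hz => ?_
  simp only [Function.comp, tangentMapWithin, coordVector]
  rw [mfderivWithin_of_isOpen e.open_target hz.1]

theorem mdifferentiableAt_symm_of_differentiableAt_comp
    (he : e ∈ IsManifold.maximalAtlas (𝓡 m) ∞ M)
    {f : M → ℝ} {y : EuclideanSpace ℝ (Fin m)} (hy : y ∈ e.target)
    (hf : DifferentiableAt ℝ (fun z => f (e.symm z)) y) :
    MDifferentiableAt (𝓡 m) 𝓘(ℝ, ℝ) f (e.symm y) := by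
  have h1 : MDifferentiableAt (𝓡 m) 𝓘(ℝ, ℝ) (fun z => f (e.symm z)) (e (e.symm y)) := by
    rw [e.right_inv hy]; exact hf.mdifferentiableAt
  have h2 := h1.comp (e.symm y)
    ((mdifferentiable_of_mem_maximalAtlas he).mdifferentiableAt (e.map_target hy))
  refine h2.congr_of_eventuallyEq ?_
  filter_upwards [e.open_source.mem_nhds (e.map_target hy)] with x hx
  simp [e.left_inv hx]

theorem mfderiv_coordVector (he : e ∈ IsManifold.maximalAtlas (𝓡 m) ∞ M)
    {f : M → ℝ} {y : EuclideanSpace ℝ (Fin m)} (hy : y ∈ e.target)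
    (hf : DifferentiableAt ℝ (fun z => f (e.symm z)) y) (v : EuclideanSpace ℝ (Fin m)) :
    mfderiv (𝓡 m) 𝓘(ℝ, ℝ) f (e.symm y) (coordVector e y v) =
      fderiv ℝ (fun z => f (e.symm z)) y v := by
  have h := mfderiv_comp y (mdifferentiableAt_symm_of_differentiableAt_comp he hy hf)
    ((mdifferentiable_of_mem_maximalAtlas he).mdifferentiableAt_symm hy)
  rw [← mfderiv_eq_fderiv]
  exact (DFunLike.congr_fun h v).symm

theorem mfderiv_symm_add_smul (he : e ∈ IsManifold.maximalAtlas (𝓡 m) ∞ M)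
    {y w : EuclideanSpace ℝ (Fin m)} {t : ℝ} (ht : y + t • w ∈ e.target) :
    mfderiv 𝓘(ℝ, ℝ) (𝓡 m) (fun s : ℝ => e.symm (y + s • w)) t 1 =
      coordVector e (y + t • w) w := by
  have hline : HasFDerivAt (fun s : ℝ => y + s • w) (ContinuousLinearMap.toSpanSingleton ℝ w) t :=
    (ContinuousLinearMap.toSpanSingleton ℝ w).hasFDerivAt.const_add y
  have hcomp := ((mdifferentiable_of_mem_maximalAtlas he).mdifferentiableAt_symm
    ht).hasMFDerivAt.comp t hline.hasMFDerivAt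
  refine (DFunLike.congr_fun hcomp.mfderiv (1 : ℝ)).trans ?_
  exact congrArg (coordVector e (y + t • w)) (one_smul ℝ w)

section Metric

variable [IsManifold (𝓡 m) ∞ M] [RiemannianBundle (fun x : M => TangentSpace (𝓡 m) x)]

variable (m M) in
theorem isContinuousRiemannianBundle_tangentSpace
    [IsContMDiffRiemannianBundle (𝓡 m) ∞ (EuclideanSpace ℝ (Fin m))
      (fun x : M => TangentSpace (𝓡 m) x)] :
    IsContinuousRiemannianBundle (EuclideanSpace ℝ (Fin m))
      (fun x : M => TangentSpace (𝓡 m) x) := by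
  obtain ⟨g, hg, h⟩ := IsContMDiffRiemannianBundle.exists_contMDiff (IB := 𝓡 m) (n := ∞)
    (F := EuclideanSpace ℝ (Fin m)) (E := fun x : M => TangentSpace (𝓡 m) x)
  exact ⟨g, hg.continuous, h⟩

theorem continuousOn_inner_coordVector
    [IsContMDiffRiemannianBundle (𝓡 m) ∞ (EuclideanSpace ℝ (Fin m))
      (fun x : M => TangentSpace (𝓡 m) x)]
    (he : e ∈ IsManifold.maximalAtlas (𝓡 m) ∞ M) (v w : EuclideanSpace ℝ (Fin m)) :
    ContinuousOn (fun y => ⟪coordVector e y v, coordVector e y w⟫_ℝ) e.target := by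
  have := isContinuousRiemannianBundle_tangentSpace m M
  have h (v : EuclideanSpace ℝ (Fin m)) : ContinuousOn (fun y : EuclideanSpace ℝ (Fin m) =>
      (TotalSpace.mk (e.symm y) (coordVector e y v) : TangentBundle (𝓡 m) M)) e.target :=
    (continuousOn_coordVector he).comp (f := fun y => (y, v)) (by fun_prop)
      fun y hy => ⟨hy, mem_univ _⟩
  exact (h v).inner_bundle (h w)

theorem continuousOn_norm_coordVector
    [IsContMDiffRiemannianBundle (𝓡 m) ∞ (EuclideanSpace ℝ (Fin m))
      (fun x : M => TangentSpace (𝓡 m) x)]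
    (he : e ∈ IsManifold.maximalAtlas (𝓡 m) ∞ M) :
    ContinuousOn (fun z : EuclideanSpace ℝ (Fin m) × EuclideanSpace ℝ (Fin m) =>
      ‖coordVector e z.1 z.2‖) (e.target ×ˢ univ) := by
  have := isContinuousRiemannianBundle_tangentSpace m M
  have := (continuousOn_coordVector he).inner_bundle (continuousOn_coordVector he)
  refine (Real.continuous_sqrt.comp_continuousOn this).congr fun z _ => ?_
  exact norm_eq_sqrt_real_inner _

end Metric

end Charts

section Distance

variable {m : ℕ} {M : Type*} [MetricSpace M] [ChartedSpace (EuclideanSpace ℝ (Fin m)) M]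
  [RiemannianBundle (fun x : M => TangentSpace (𝓡 m) x)]
  {e : OpenPartialHomeomorph M (EuclideanSpace ℝ (Fin m))}

theorem dist_symm_le [IsRiemannianManifold (𝓡 m) M]
    (he : e ∈ IsManifold.maximalAtlas (𝓡 m) ∞ M)
    {y w : EuclideanSpace ℝ (Fin m)} {C : ℝ}
    (hmem : ∀ t ∈ Icc (0 : ℝ) 1, y + t • w ∈ e.target)
    (hbd : ∀ t ∈ Icc (0 : ℝ) 1, ‖coordVector e (y + t • w) w‖ ≤ C) :
    dist (e.symm y) (e.symm (y + w)) ≤ C := by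
  have hC : 0 ≤ C := (norm_nonneg _).trans (hbd 0 ⟨le_rfl, zero_le_one⟩)
  set γ : ℝ → M := fun t => e.symm (y + t • w) with hγ
  have hline : ContDiff ℝ ∞ (fun t : ℝ => y + t • w) := by fun_prop
  have hsmooth : ContMDiffOn 𝓘(ℝ, ℝ) (𝓡 m) 1 γ (Icc 0 1) :=
    ((contMDiffOn_symm_of_mem_maximalAtlas he).of_le (by simp)).comp
      ((hline.of_le (by simp)).contMDiff.contMDiffOn) hmem
  have hle := riemannianEDist_le_pathELength hsmooth (x := e.symm y) (y := e.symm (y + w))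
    (by simp [hγ]) (by simp [hγ]) zero_le_one
  rw [← IsRiemannianManifold.out (I := 𝓡 m), pathELength_eq_lintegral_mfderiv_Icc] at hle
  have hspeed : ∫⁻ t in Icc (0 : ℝ) 1, ‖mfderiv 𝓘(ℝ, ℝ) (𝓡 m) γ t 1‖ₑ
      ≤ ∫⁻ _ in Icc (0 : ℝ) 1, ENNReal.ofReal C := by
    refine setLIntegral_mono' measurableSet_Icc fun t ht => ?_
    rw [mfderiv_symm_add_smul he (hmem t ht), ← ofReal_norm]
    exact ENNReal.ofReal_le_ofReal (hbd t ht)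
  have := hle.trans hspeed
  rw [edist_dist] at this
  simpa [ENNReal.ofReal_le_ofReal_iff hC] using this

variable [IsManifold (𝓡 m) ∞ M] [IsContMDiffRiemannianBundle (𝓡 m) ∞ (EuclideanSpace ℝ (Fin m))
  (fun x : M => TangentSpace (𝓡 m) x)]

theorem exists_norm_coordVector_le (he : e ∈ IsManifold.maximalAtlas (𝓡 m) ∞ M)
    {y : EuclideanSpace ℝ (Fin m)} (hy : y ∈ e.target) :
    ∃ ε > 0, ∃ C ≥ 0, ∀ z ∈ Metric.ball y ε, z ∈ e.target ∧
      ∀ w, ‖coordVector e z w‖ ≤ C * ‖w‖ := by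
  have hmem : e.target ×ˢ univ ∈ 𝓝 (y, (0 : EuclideanSpace ℝ (Fin m))) :=
    prod_mem_nhds (e.open_target.mem_nhds hy) univ_mem
  have norm_lt : ∀ᶠ z in 𝓝 (y, (0 : EuclideanSpace ℝ (Fin m))), ‖coordVector e z.1 z.2‖ < 1 :=
    ((continuousOn_norm_coordVector he).continuousAt hmem).eventually_lt continuousAt_const
      (by simp [coordVector_zero])
  obtain ⟨ε, hε, h⟩ := Metric.eventually_nhds_iff_ball.1 (norm_lt.and hmem)
  rw [← ball_prod_same] at h
  refine ⟨ε, hε, 2 / ε, by positivity, fun z hz =>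
    ⟨(h (z, 0) ⟨hz, Metric.mem_ball_self hε⟩).2.1, fun w => ?_⟩⟩
  rcases eq_or_ne w 0 with rfl | hw
  · simp [coordVector_zero]
  have : 0 < ‖w‖ := norm_pos_iff.2 hw
  have hscale : (ε / (2 * ‖w‖)) • w ∈ Metric.ball 0 ε := by
    rw [mem_ball_zero_iff, norm_smul, Real.norm_of_nonneg (by positivity)]
    field_simp
    norm_num
  have norm_scaled := (h (z, _) ⟨hz, hscale⟩).1.le
  rw [coordVector_smul, norm_smul, Real.norm_of_nonneg (by positivity)] at norm_scaled
  calc ‖coordVector e z w‖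
      = 2 / ε * ‖w‖ * (ε / (2 * ‖w‖) * ‖coordVector e z w‖) := by field_simp
    _ ≤ 2 / ε * ‖w‖ := mul_le_of_le_one_right (by positivity) norm_scaled

theorem eventually_dist_symm_add_smul_le [IsRiemannianManifold (𝓡 m) M]
    (he : e ∈ IsManifold.maximalAtlas (𝓡 m) ∞ M)
    {y : EuclideanSpace ℝ (Fin m)} (hy : y ∈ e.target) (v : EuclideanSpace ℝ (Fin m))
    {C : ℝ} (hC : ‖coordVector e y v‖ < C) :
    ∀ᶠ t : ℝ in 𝓝 0, dist (e.symm y) (e.symm (y + t • v)) ≤ C * |t| := by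
  have hmem : e.target ×ˢ univ ∈ 𝓝 (y, v) :=
    prod_mem_nhds (e.open_target.mem_nhds hy) univ_mem
  have norm_lt : ∀ᶠ z in 𝓝 (y, v), ‖coordVector e z.1 z.2‖ < C :=
    ((continuousOn_norm_coordVector he).continuousAt hmem).eventually_lt continuousAt_const hC
  have hline : Tendsto (fun t : ℝ => (y + t • v, v)) (𝓝 0) (𝓝 (y, v)) := by
    have : Continuous fun t : ℝ => (y + t • v, v) := by fun_prop
    simpa using this.tendsto 0
  obtain ⟨ε, hε, h⟩ := Metric.eventually_nhds_iff_ball.1 (hline.eventually (norm_lt.and hmem))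
  filter_upwards [Metric.ball_mem_nhds (0 : ℝ) hε] with t ht
  have hsub : ∀ s ∈ Icc (0 : ℝ) 1, s * t ∈ Metric.ball (0 : ℝ) ε := fun s hs => by
    rw [mem_ball_zero_iff, norm_mul, Real.norm_of_nonneg hs.1]
    exact (mul_le_of_le_one_left (norm_nonneg _) hs.2).trans_lt (mem_ball_zero_iff.1 ht)
  refine dist_symm_le he (fun s hs => ?_) (fun s hs => ?_)
  · rw [smul_smul]
    exact (h _ (hsub s hs)).2.1
  · rw [smul_smul, coordVector_smul, norm_smul, mul_comm, Real.norm_eq_abs]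
    gcongr
    exact (h _ (hsub s hs)).1.le

variable [IsRiemannianManifold (𝓡 m) M]

theorem locallyLipschitzOn_symm (he : e ∈ IsManifold.maximalAtlas (𝓡 m) ∞ M) :
    LocallyLipschitzOn e.target e.symm := by
  intro y hy
  obtain ⟨ε, hε, C, hC, h⟩ := exists_norm_coordVector_le he hy
  refine ⟨C.toNNReal, Metric.ball y ε, mem_nhdsWithin_of_mem_nhds (Metric.ball_mem_nhds y hε),
    LipschitzOnWith.of_dist_le_mul fun z hz w hw => ?_⟩
  have hseg : ∀ t ∈ Icc (0 : ℝ) 1, z + t • (w - z) ∈ Metric.ball y ε := fun t ht =>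
    (convex_ball y ε).add_smul_sub_mem hz hw ht
  have := dist_symm_le he (y := z) (w := w - z) (fun t ht => (h _ (hseg t ht)).1)
    (fun t ht => (h _ (hseg t ht)).2 _)
  rw [Real.coe_toNNReal C hC, dist_comm z w, dist_eq_norm w z]
  rwa [add_sub_cancel] at this

theorem abs_fderiv_comp_symm_le (he : e ∈ IsManifold.maximalAtlas (𝓡 m) ∞ M)
    {f : M → ℝ} {y : EuclideanSpace ℝ (Fin m)} (hy : y ∈ e.target) {L : ℝ≥0}
    (hf : ∀ᶠ x in 𝓝 (e.symm y), dist (f x) (f (e.symm y)) ≤ L * dist x (e.symm y))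
    (hd : DifferentiableAt ℝ (fun z => f (e.symm z)) y) (v : EuclideanSpace ℝ (Fin m)) :
    |fderiv ℝ (fun z => f (e.symm z)) y v| ≤ L * ‖coordVector e y v‖ := by
  have bound : ∀ C > ‖coordVector e y v‖, |fderiv ℝ (fun z => f (e.symm z)) y v| ≤ L * C := by
    intro C hC
    have hC0 : 0 ≤ C := (norm_nonneg _).trans hC.le
    have hderiv : HasDerivAt (fun t : ℝ => f (e.symm (y + t • v)))
        (fderiv ℝ (fun z => f (e.symm z)) y v) 0 := hd.hasFDerivAt.hasLineDerivAt v
    have hline : Tendsto (fun t : ℝ => e.symm (y + t • v)) (𝓝 0) (𝓝 (e.symm y)) := by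
      have : Tendsto (fun t : ℝ => y + t • v) (𝓝 0) (𝓝 y) := by
        simpa using (show Continuous fun t : ℝ => y + t • v by fun_prop).tendsto 0
      exact (e.continuousAt_symm hy).tendsto.comp this
    rw [← Real.norm_eq_abs]
    refine hderiv.le_of_lip' (by positivity) ?_
    filter_upwards [hline.eventually hf, eventually_dist_symm_add_smul_le he hy v hC]
      with t hft ht
    rw [← dist_eq_norm]
    simp only [zero_smul, add_zero, sub_zero, Real.norm_eq_abs]
    rw [dist_comm] at ht
    rw [mul_assoc]
    exact hft.trans (mul_le_mul_of_nonneg_left ht L.2)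
  have hlim : Tendsto (fun C : ℝ => L * C) (𝓝[>] ‖coordVector e y v‖)
      (𝓝 (L * ‖coordVector e y v‖)) :=
    (tendsto_const_nhds.mul tendsto_id).mono_left nhdsWithin_le_nhds
  exact ge_of_tendsto hlim (eventually_mem_nhdsWithin.mono bound)

end Distance

theorem eventually_dist_le_of_hasDerivAt {G : ℝ → ℝ} {G' t c : ℝ} (hG : HasDerivAt G G' t)
    (hc : |G'| < c) : ∀ᶠ s in 𝓝 t, dist (G s) (G t) ≤ c * dist s t := by
  filter_upwards [(hasDerivAt_iff_isLittleO.1 hG).bound (sub_pos.2 hc)] with s hs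
  simp only [smul_eq_mul, Real.norm_eq_abs] at hs
  rw [Real.dist_eq, Real.dist_eq]
  calc |G s - G t| = |(G s - G t - (s - t) * G') + (s - t) * G'| := by rw [sub_add_cancel]
    _ ≤ |G s - G t - (s - t) * G'| + |(s - t) * G'| := abs_add_le _ _
    _ ≤ (c - |G'|) * |s - t| + |s - t| * |G'| := by rw [abs_mul]; gcongr
    _ = c * |s - t| := by ring

section Gradient

variable {m : ℕ} {M : Type*}

instance finiteDimensional_tangentSpace [TopologicalSpace M]
    [ChartedSpace (EuclideanSpace ℝ (Fin m)) M] (x : M) :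
    FiniteDimensional ℝ (TangentSpace (𝓡 m) x) :=
  inferInstanceAs (FiniteDimensional ℝ (EuclideanSpace ℝ (Fin m)))

variable (m) in
/-- The Riemannian gradient of a function, with value zero where it is not differentiable. -/
def grad [TopologicalSpace M] [ChartedSpace (EuclideanSpace ℝ (Fin m)) M]
    [RiemannianBundle (fun x : M => TangentSpace (𝓡 m) x)]
    (f : M → ℝ) (x : M) : TangentSpace (𝓡 m) x :=
  haveI : CompleteSpace (TangentSpace (𝓡 m) x) := FiniteDimensional.complete ℝ _
  (InnerProductSpace.toDual ℝ (TangentSpace (𝓡 m) x)).symm (mfderiv (𝓡 m) 𝓘(ℝ, ℝ) f x)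

theorem inner_grad [TopologicalSpace M] [ChartedSpace (EuclideanSpace ℝ (Fin m)) M]
    [RiemannianBundle (fun x : M => TangentSpace (𝓡 m) x)]
    (f : M → ℝ) (x : M) (v : TangentSpace (𝓡 m) x) :
    ⟪grad m f x, v⟫_ℝ = mfderiv (𝓡 m) 𝓘(ℝ, ℝ) f x v := by
  have : CompleteSpace (TangentSpace (𝓡 m) x) := FiniteDimensional.complete ℝ _
  exact InnerProductSpace.toDual_symm_apply

variable [MetricSpace M] [ChartedSpace (EuclideanSpace ℝ (Fin m)) M]
  [RiemannianBundle (fun x : M => TangentSpace (𝓡 m) x)]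

theorem inner_grad_coordVector {e : OpenPartialHomeomorph M (EuclideanSpace ℝ (Fin m))}
    (he : e ∈ IsManifold.maximalAtlas (𝓡 m) ∞ M)
    {f : M → ℝ} {y : EuclideanSpace ℝ (Fin m)} (hy : y ∈ e.target)
    (hf : DifferentiableAt ℝ (fun z => f (e.symm z)) y) (v : EuclideanSpace ℝ (Fin m)) :
    ⟪grad m f (e.symm y), coordVector e y v⟫_ℝ = fderiv ℝ (fun z => f (e.symm z)) y v := by
  rw [inner_grad, mfderiv_coordVector he hy hf]

variable [IsManifold (𝓡 m) ∞ M] [IsContMDiffRiemannianBundle (𝓡 m) ∞ (EuclideanSpace ℝ (Fin m))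
    (fun x : M => TangentSpace (𝓡 m) x)] [IsRiemannianManifold (𝓡 m) M]

theorem norm_grad_le {f : M → ℝ} {x : M} {L : ℝ≥0}
    (hf : ∀ᶠ z in 𝓝 x, dist (f z) (f x) ≤ L * dist z x) : ‖grad m f x‖ ≤ L := by
  suffices h : ‖grad m f x‖ * ‖grad m f x‖ ≤ L * ‖grad m f x‖ by
    by_contra! hlt
    exact h.not_gt (mul_lt_mul_of_pos_right hlt (L.2.trans_lt hlt))
  rw [← real_inner_self_eq_norm_mul_norm]
  by_cases hx : MDifferentiableAt (𝓡 m) 𝓘(ℝ, ℝ) f x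
  swap
  · rw [inner_grad, mfderiv_zero_of_not_mdifferentiableAt hx]
    exact mul_nonneg L.2 (norm_nonneg _)
  obtain ⟨e, he, y, hy, rfl⟩ : ∃ e ∈ IsManifold.maximalAtlas (𝓡 m) ∞ M,
      ∃ y ∈ e.target, e.symm y = x :=
    ⟨chartAt _ x, IsManifold.chart_mem_maximalAtlas x, _, mem_chart_target _ x,
      (chartAt _ x).left_inv (mem_chart_source _ x)⟩
  have hd : DifferentiableAt ℝ (fun z => f (e.symm z)) y :=
    (hx.comp y ((mdifferentiable_of_mem_maximalAtlas he).mdifferentiableAt_symm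
      hy)).differentiableAt
  have := abs_fderiv_comp_symm_le he hy hf hd (chartComponents e y (grad m f (e.symm y)))
  rw [← inner_grad_coordVector he hy hd, coordVector_chartComponents he hy] at this
  exact (le_abs_self _).trans this

theorem norm_grad_comp_le {r : M → ℝ} {K : ℝ≥0} (hr : LipschitzWith K r) {G : ℝ → ℝ} {G' : ℝ}
    {x : M} (hG : HasDerivAt G G' (r x)) :
    ‖grad m (fun z => G (r z)) x‖ ≤ |G'| * K := by
  have bound : ∀ c > |G'|, ‖grad m (fun z => G (r z)) x‖ ≤ c * K := by
    intro c hc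
    lift c to ℝ≥0 using (abs_nonneg _).trans hc.le
    refine mod_cast norm_grad_le (L := c * K) ?_
    filter_upwards [hr.continuous.continuousAt.eventually
      (eventually_dist_le_of_hasDerivAt hG hc)] with z hz
    calc dist (G (r z)) (G (r x)) ≤ c * dist (r z) (r x) := hz
      _ ≤ c * (K * dist z x) := by gcongr; exact hr.dist_le_mul z x
      _ = (c * K : ℝ≥0) * dist z x := by push_cast; ring
  have hlim : Tendsto (fun c : ℝ => c * K) (𝓝[>] |G'|) (𝓝 (|G'| * K)) :=
    (tendsto_id.mul tendsto_const_nhds).mono_left nhdsWithin_le_nhds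
  exact ge_of_tendsto hlim (eventually_mem_nhdsWithin.mono bound)

end Gradient

section Limits

variable {α : Type*} [MeasurableSpace α] {μ : Measure α}

/- Since `|F n - f| ≤ G n + g`, splitting at the level `2 g` gives
`|F n - f| ≤ min |F n - f| (2 g) + max (g - G n) 0 + (G n - g)`: the first two terms are dominated
by `3 g` and the third one has small integral by assumption. -/
theorem tendsto_integral_abs_sub_of_abs_le {F G : ℕ → α → ℝ} {f g : α → ℝ}
    (hF : ∀ n, Integrable (F n) μ) (hG : ∀ n, Integrable (G n) μ) (hf : Integrable f μ)
    (hg : Integrable g μ) (hFG : ∀ n x, |F n x| ≤ G n x)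
    (hFf : ∀ᵐ x ∂μ, Tendsto (fun n => F n x) atTop (𝓝 (f x)))
    (hGg : ∀ᵐ x ∂μ, Tendsto (fun n => G n x) atTop (𝓝 (g x)))
    (hinteg : Tendsto (fun n => ∫ x, G n x ∂μ) atTop (𝓝 (∫ x, g x ∂μ))) :
    Tendsto (fun n => ∫ x, |F n x - f x| ∂μ) atTop (𝓝 0) := by
  have hfg : ∀ᵐ x ∂μ, |f x| ≤ g x := by
    filter_upwards [hFf, hGg] with x hfx hgx
    exact le_of_tendsto_of_tendsto' hfx.abs hgx fun n => hFG n x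
  set D : ℕ → α → ℝ := fun n x => min |F n x - f x| (2 * g x) + max (g x - G n x) 0
  have hD : ∀ n, Integrable (D n) μ := fun n =>
    (((hF n).sub hf).abs.inf (hg.const_mul 2)).add (hg.sub (hG n)).pos_part
  have tendsto_D : Tendsto (fun n => ∫ x, D n x ∂μ) atTop (𝓝 (∫ _, (0 : ℝ) ∂μ)) := by
    refine tendsto_integral_of_dominated_convergence (fun x => 3 * g x)
      (fun n => (hD n).aestronglyMeasurable) (hg.const_mul 3) (fun n => ?_) ?_
    · filter_upwards [hfg] with x hx
      have hg0 := (abs_nonneg _).trans hx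
      have hG0 := (abs_nonneg _).trans (hFG n x)
      have hmin : 0 ≤ min |F n x - f x| (2 * g x) := le_min (abs_nonneg _) (by positivity)
      rw [Real.norm_of_nonneg (add_nonneg hmin (le_max_right _ _))]
      have := min_le_right |F n x - f x| (2 * g x)
      have := max_le (show g x - G n x ≤ g x by linarith) hg0
      linarith
    · filter_upwards [hfg, hFf, hGg] with x hx hfx hgx
      have h1 := (hfx.sub_const (f x)).abs.min (tendsto_const_nhds (x := 2 * g x))
      have h2 := (hgx.const_sub (g x)).max (tendsto_const_nhds (x := (0 : ℝ)))
      simpa [(abs_nonneg _).trans hx] using h1.add h2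
  refine squeeze_zero (fun n => integral_nonneg fun x => abs_nonneg _) (fun n => ?_)
    (show Tendsto (fun n => ∫ x, D n x ∂μ + (∫ x, G n x ∂μ - ∫ x, g x ∂μ)) atTop (𝓝 0) by
      simpa using tendsto_D.add (hinteg.sub_const (∫ x, g x ∂μ)))
  have hGsub : Integrable (fun x => G n x - g x) μ := (hG n).sub hg
  rw [← integral_sub (hG n) hg, ← integral_add (hD n) hGsub]
  refine integral_mono_ae ((hF n).sub hf).abs ((hD n).add hGsub) ?_
  filter_upwards [hfg] with x hx
  have := abs_sub (F n x) (f x)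
  have := hFG n x
  simp only [D]
  rcases min_cases |F n x - f x| (2 * g x) with h | h <;>
    rcases max_cases (g x - G n x) 0 with h' | h' <;> linarith

theorem integrable_lipschitz_comp_mul {w b : α → ℝ} {h : ℝ → ℝ} {L : ℝ≥0}
    (hh : LipschitzWith L h) (hw : Integrable w μ) {B : ℝ} (hb : Integrable b μ)
    (hB : ∀ x, ‖b x‖ ≤ B) : Integrable (fun x => h (w x) * b x) μ := by
  have hsub : Integrable (fun x => (h (w x) - h 0) * b x) μ := by
    refine Integrable.mul_bdd (c := B) ((hw.norm.const_mul (L : ℝ)).mono'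
      ((hh.continuous.comp_aestronglyMeasurable hw.aestronglyMeasurable).sub
        aestronglyMeasurable_const) (Eventually.of_forall fun x => ?_))
      hb.aestronglyMeasurable (Eventually.of_forall hB)
    simpa [Real.dist_eq] using hh.dist_le_mul (w x) 0
  exact (hsub.add (hb.const_mul (h 0))).congr (Eventually.of_forall fun x => by
    simp only [Pi.add_apply]; ring)

theorem integrable_bounded_comp_mul_mul {w f b : α → ℝ} {k : ℝ → ℝ} {L B : ℝ}
    (hk : Continuous k) (hL : ∀ t, ‖k t‖ ≤ L) (hw : AEStronglyMeasurable w μ)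
    (hf : Integrable f μ) (hb : AEStronglyMeasurable b μ) (hB : ∀ x, ‖b x‖ ≤ B) :
    Integrable (fun x => k (w x) * f x * b x) μ :=
  (hf.bdd_mul (c := L) (hk.comp_aestronglyMeasurable hw) (Eventually.of_forall fun _ =>
    hL _)).mul_bdd (c := B) hb (Eventually.of_forall hB)

theorem setIntegral_mul_eq_integral_indicator_mul {Ω K : Set α} (hKΩ : K ⊆ Ω) {f ζ : α → ℝ}
    (hζ : ∀ x ∉ K, ζ x = 0) : ∫ x in Ω, f x * ζ x ∂μ = ∫ x, K.indicator f x * ζ x ∂μ := by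
  rw [setIntegral_eq_integral_of_forall_compl_eq_zero fun x hx => by
    rw [hζ x fun hxK => hx (hKΩ hxK), mul_zero]]
  refine integral_congr_ae (Eventually.of_forall fun x => ?_)
  by_cases hx : x ∈ K
  · simp only [indicator_of_mem hx]
  · simp only [hζ x hx, mul_zero]

variable {U : α → ℝ} {u : ℕ → α → ℝ} {b : α → ℝ} {B : ℝ}

theorem tendsto_integral_lipschitz_comp_mul {h : ℝ → ℝ} {L : ℝ≥0}
    (hh : LipschitzWith L h) (hU : Integrable U μ) (hu : ∀ n, Integrable (u n) μ)
    (hlim : Tendsto (fun n => ∫ x, |u n x - U x| ∂μ) atTop (𝓝 0))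
    (hb : Integrable b μ) (hB : ∀ x, ‖b x‖ ≤ B) :
    Tendsto (fun n => ∫ x, h (u n x) * b x ∂μ) atTop (𝓝 (∫ x, h (U x) * b x ∂μ)) := by
  rw [tendsto_iff_dist_tendsto_zero]
  refine squeeze_zero (fun n => dist_nonneg) (fun n => ?_)
    (by simpa using hlim.const_mul (L * B))
  rw [dist_eq_norm, ← integral_sub (integrable_lipschitz_comp_mul hh (hu n) hb hB)
    (integrable_lipschitz_comp_mul hh hU hb hB), ← integral_const_mul]
  refine norm_integral_le_of_norm_le (((hu n).sub hU).abs.const_mul _)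
    (Eventually.of_forall fun x => ?_)
  calc ‖h (u n x) * b x - h (U x) * b x‖
      = ‖h (u n x) - h (U x)‖ * ‖b x‖ := by rw [← sub_mul, norm_mul]
    _ ≤ L * |u n x - U x| * B := by
        gcongr
        · simpa [Real.dist_eq] using hh.dist_le_mul (u n x) (U x)
        · exact hB x
    _ = L * B * |u n x - U x| := by ring

theorem tendsto_integral_bounded_comp_mul_mul {V : α → ℝ} {g : ℕ → α → ℝ} {k : ℝ → ℝ} {L : ℝ}
    (hk : Continuous k) (hL : ∀ t, ‖k t‖ ≤ L) (hu : ∀ n, AEStronglyMeasurable (u n) μ)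
    (hV : Integrable V μ) (hg : ∀ n, Integrable (g n) μ)
    (hlim : ∀ᵐ x ∂μ, Tendsto (fun n => u n x) atTop (𝓝 (U x)))
    (hlimg : Tendsto (fun n => ∫ x, |g n x - V x| ∂μ) atTop (𝓝 0))
    (hb : AEStronglyMeasurable b μ) (hB : ∀ x, ‖b x‖ ≤ B) :
    Tendsto (fun n => ∫ x, k (u n x) * g n x * b x ∂μ) atTop
      (𝓝 (∫ x, k (U x) * V x * b x ∂μ)) := by
  have hL0 : 0 ≤ L := (norm_nonneg _).trans (hL 0)
  have hinteg : ∀ n f, Integrable f μ → Integrable (fun x => k (u n x) * f x * b x) μ :=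
    fun n f hf => integrable_bounded_comp_mul_mul hk hL (hu n) hf hb hB
  have norm_le : ∀ n (f : α → ℝ) x, ‖k (u n x) * f x * b x‖ ≤ L * B * |f x| := fun n f x => by
    calc ‖k (u n x) * f x * b x‖ = ‖k (u n x)‖ * |f x| * ‖b x‖ := by
          rw [norm_mul, norm_mul, Real.norm_eq_abs (f x)]
      _ ≤ L * |f x| * B := by gcongr; exacts [hL _, hB x]
      _ = L * B * |f x| := by ring
  have freeze : Tendsto (fun n => ∫ x, k (u n x) * V x * b x ∂μ) atTop
      (𝓝 (∫ x, k (U x) * V x * b x ∂μ)) := by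
    refine tendsto_integral_of_dominated_convergence (fun x => L * B * |V x|)
      (fun n => (hinteg n V hV).aestronglyMeasurable) (hV.abs.const_mul _)
      (fun n => Eventually.of_forall (norm_le n V)) ?_
    filter_upwards [hlim] with x hx
    exact (((hk.tendsto _).comp hx).mul_const _).mul_const _
  have error : Tendsto
      (fun n => ∫ x, k (u n x) * g n x * b x ∂μ - ∫ x, k (u n x) * V x * b x ∂μ)
      atTop (𝓝 0) := by
    refine squeeze_zero_norm (fun n => ?_) (by simpa using hlimg.const_mul (L * B))
    rw [← integral_sub (hinteg n _ (hg n)) (hinteg n V hV), ← integral_const_mul]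
    refine norm_integral_le_of_norm_le (((hg n).sub hV).abs.const_mul _)
      (Eventually.of_forall fun x => ?_)
    rw [← sub_mul, ← mul_sub]
    exact norm_le n (fun x => g n x - V x) x
  simpa using error.add freeze

end Limits

section Mollification

/-- A sequence of bump functions at the origin whose supports shrink to it. -/
def shrinkingBump (E : Type*) [NormedAddCommGroup E] (n : ℕ) : ContDiffBump (0 : E) where
  rIn := 1 / (n + 1)
  rOut := 2 / (n + 1)
  rIn_pos := by positivity
  rIn_lt_rOut := by gcongr; norm_num

theorem tendsto_rOut_shrinkingBump {E : Type*} [NormedAddCommGroup E] :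
    Tendsto (fun n => (shrinkingBump E n).rOut) atTop (𝓝 0) := by
  have := (tendsto_one_div_add_atTop_nhds_zero_nat (𝕜 := ℝ)).const_mul 2
  simpa [shrinkingBump, div_eq_mul_inv] using this

variable {E : Type*} [NormedAddCommGroup E] [NormedSpace ℝ E] [FiniteDimensional ℝ E]
  [MeasurableSpace E] [BorelSpace E] (μ : Measure E) [μ.IsAddHaarMeasure]

/-- The mollification of `f` at scale `1 / (n + 1)`: its convolution with the normalized
`shrinkingBump E n`. -/
def mollify (f : E → ℝ) (n : ℕ) : E → ℝ :=
  (shrinkingBump E n).normed μ ⋆[ContinuousLinearMap.lsmul ℝ ℝ, μ] f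

theorem mollify_apply (f : E → ℝ) (n : ℕ) (x : E) :
    mollify μ f n x = ∫ t, f t * (shrinkingBump E n).normed μ (x - t) ∂μ := by
  rw [mollify, convolution_eq_swap]
  simp [mul_comm]

theorem integrable_normed_shrinkingBump (n : ℕ) :
    Integrable ((shrinkingBump E n).normed μ) μ :=
  (shrinkingBump E n).continuous_normed.integrable_of_hasCompactSupport
    (shrinkingBump E n).hasCompactSupport_normed

variable {f : E → ℝ}

theorem integrable_mollify (hf : Integrable f μ) (n : ℕ) : Integrable (mollify μ f n) μ :=
  (integrable_normed_shrinkingBump μ n).integrable_convolution _ hf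

theorem integral_mollify (hf : Integrable f μ) (n : ℕ) :
    ∫ x, mollify μ f n x ∂μ = ∫ x, f x ∂μ := by
  rw [mollify, integral_convolution _ (integrable_normed_shrinkingBump μ n) hf,
    ContDiffBump.integral_normed]
  simp

theorem abs_mollify_le (f : E → ℝ) (n : ℕ) (x : E) :
    |mollify μ f n x| ≤ mollify μ (fun t => |f t|) n x := by
  rw [mollify_apply, mollify_apply, ← Real.norm_eq_abs]
  refine (norm_integral_le_integral_norm _).trans_eq (integral_congr_ae ?_)
  filter_upwards with t
  rw [norm_mul, Real.norm_eq_abs, Real.norm_of_nonneg ((shrinkingBump E n).nonneg_normed _)]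

theorem ae_tendsto_mollify (hf : Integrable f μ) :
    ∀ᵐ x ∂μ, Tendsto (fun n => mollify μ f n x) atTop (𝓝 (f x)) :=
  ContDiffBump.ae_convolution_tendsto_right_of_locallyIntegrable (K := 2)
    tendsto_rOut_shrinkingBump (Eventually.of_forall fun n => by simp [shrinkingBump]; rfl)
    hf.locallyIntegrable

theorem tendsto_integral_abs_mollify_sub (hf : Integrable f μ) :
    Tendsto (fun n => ∫ x, |mollify μ f n x - f x| ∂μ) atTop (𝓝 0) :=
  tendsto_integral_abs_sub_of_abs_le (integrable_mollify μ hf) (integrable_mollify μ hf.abs) hf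
    hf.abs (abs_mollify_le μ f) (ae_tendsto_mollify μ hf) (ae_tendsto_mollify μ hf.abs)
    (by simp only [integral_mollify μ hf.abs, tendsto_const_nhds])

theorem contDiff_mollify (hf : LocallyIntegrable f μ) (n : ℕ) : ContDiff ℝ ∞ (mollify μ f n) :=
  (shrinkingBump E n).hasCompactSupport_normed.contDiff_convolution_left _
    (shrinkingBump E n).contDiff_normed hf

theorem fderiv_mollify_apply (hf : LocallyIntegrable f μ) (n : ℕ) (x v : E) :
    fderiv ℝ (mollify μ f n) x v =
      ∫ t, f t * fderiv ℝ ((shrinkingBump E n).normed μ) (x - t) v ∂μ := by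
  set ρ := (shrinkingBump E n).normed μ
  have ρ_support : HasCompactSupport ρ := (shrinkingBump E n).hasCompactSupport_normed
  have ρ_smooth : ContDiff ℝ 1 ρ := (shrinkingBump E n).contDiff_normed
  have h := ρ_support.hasFDerivAt_convolution_left (ContinuousLinearMap.lsmul ℝ ℝ) ρ_smooth hf x
  rw [mollify, h.fderiv, convolution_eq_swap, ContinuousLinearMap.integral_apply]
  · refine integral_congr_ae (Eventually.of_forall fun t => ?_)
    simp [ContinuousLinearMap.precompL_apply, mul_comm]
  · exact ((ρ_support.fderiv ℝ).convolutionExists_left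
      ((ContinuousLinearMap.lsmul ℝ ℝ : ℝ →L[ℝ] ℝ →L[ℝ] ℝ).precompL E)
      (ρ_smooth.continuous_fderiv one_ne_zero) hf x).integrable_swap

theorem tsupport_normed_shrinkingBump_sub_subset (n : ℕ) (x : E) :
    tsupport (fun t => (shrinkingBump E n).normed μ (x - t)) ⊆
      Metric.closedBall x (shrinkingBump E n).rOut := by
  refine closure_minimal (fun t ht => ?_) Metric.isClosed_closedBall
  have hxt : x - t ∈ Function.support ((shrinkingBump E n).normed μ) := ht
  rw [ContDiffBump.support_normed_eq, mem_ball_zero_iff] at hxt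
  rw [Metric.mem_closedBall', dist_eq_norm]
  exact hxt.le

end Mollification

section WeakDerivative

variable {E : Type*} [NormedAddCommGroup E] [NormedSpace ℝ E]

theorem fderiv_apply_eq_zero_of_notMem_tsupport {ζ : E → ℝ} {x : E} (hx : x ∉ tsupport ζ)
    (v : E) : fderiv ℝ ζ x v = 0 := by
  rw [image_eq_zero_of_notMem_tsupport fun h => hx (tsupport_fderiv_subset ℝ h)]
  rfl

variable [MeasurableSpace E]

/-- `g` is the weak derivative of `w` in the direction `v` on `Ω`, tested against smooth functions
with compact support in `Ω`. -/
def HasWeakDerivOn (μ : Measure E) (Ω : Set E) (v : E) (w g : E → ℝ) : Prop :=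
  ∀ ζ : E → ℝ, ContDiff ℝ ∞ ζ → HasCompactSupport ζ → tsupport ζ ⊆ Ω →
    ∫ y in Ω, w y * fderiv ℝ ζ y v ∂μ = -∫ y in Ω, g y * ζ y ∂μ

variable {μ : Measure E} [FiniteDimensional ℝ E] [BorelSpace E] [μ.IsAddHaarMeasure]

theorem HasWeakDerivOn.fderiv_mollify {Ω : Set E} {v : E} {w g : E → ℝ}
    (hwg : HasWeakDerivOn μ Ω v w g) {K : Set E} (hK : MeasurableSet K) (hKΩ : K ⊆ Ω)
    (hw : IntegrableOn w K μ) {n : ℕ} {x : E}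
    (hx : Metric.closedBall x (shrinkingBump E n).rOut ⊆ K) :
    fderiv ℝ (mollify μ (K.indicator w) n) x v = mollify μ (K.indicator g) n x := by
  set ρ := (shrinkingBump E n).normed μ
  have ρ_smooth : ContDiff ℝ ∞ ρ := (shrinkingBump E n).contDiff_normed
  set ζ : E → ℝ := fun t => ρ (x - t)
  have ζ_smooth : ContDiff ℝ ∞ ζ := ρ_smooth.comp (contDiff_const.sub contDiff_id)
  have tsupport_ζ : tsupport ζ ⊆ Metric.closedBall x (shrinkingBump E n).rOut :=
    tsupport_normed_shrinkingBump_sub_subset μ n x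
  have ζ_support : HasCompactSupport ζ :=
    (isCompact_closedBall x _).of_isClosed_subset (isClosed_tsupport _) tsupport_ζ
  have fderiv_ζ : ∀ t, fderiv ℝ ζ t v = -fderiv ℝ ρ (x - t) v := fun t => by
    have h := (ρ_smooth.differentiable (by simp) (x - t)).hasFDerivAt.comp t
      ((hasFDerivAt_const x t).sub (hasFDerivAt_id t))
    rw [show fderiv ℝ ζ t = _ from h.fderiv]
    simp
  have eq_zero : ∀ t ∉ K, ζ t = 0 := fun t ht =>
    image_eq_zero_of_notMem_tsupport fun h => ht (hx (tsupport_ζ h))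
  have fderiv_eq_zero : ∀ t ∉ K, fderiv ℝ ζ t v = 0 := fun t ht =>
    fderiv_apply_eq_zero_of_notMem_tsupport (fun h => ht (hx (tsupport_ζ h))) v
  rw [fderiv_mollify_apply μ ((integrable_indicator_iff hK).2 hw).locallyIntegrable,
    mollify_apply, ← setIntegral_mul_eq_integral_indicator_mul hKΩ eq_zero,
    ← neg_eq_iff_eq_neg.2 (hwg ζ ζ_smooth ζ_support (tsupport_ζ.trans (hx.trans hKΩ))),
    setIntegral_mul_eq_integral_indicator_mul hKΩ fderiv_eq_zero, ← integral_neg]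
  simp only [fderiv_ζ, mul_neg, neg_neg, ρ]

variable {h : ℝ → ℝ} {η ζ : E → ℝ} {D : ℝ≥0}

/- Integrate by parts the Lipschitz function `η` against `h (w ·) ζ`. -/
theorem integral_comp_mul_lipschitz_mul_fderiv (hh : ContDiff ℝ 1 h) (hη : LipschitzWith D η)
    (hζ : ContDiff ℝ 1 ζ) (hζc : HasCompactSupport ζ) (v : E) {w : E → ℝ} (hw : ContDiff ℝ 1 w) :
    ∫ x, h (w x) * (η x * fderiv ℝ ζ x v) ∂μ =
      -(∫ x, deriv h (w x) * fderiv ℝ w x v * (η x * ζ x) ∂μ +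
        ∫ x, h (w x) * (lineDeriv ℝ η x v * ζ x) ∂μ) := by
  have hG : ContDiff ℝ 1 fun x => h (w x) * ζ x := (hh.comp hw).mul hζ
  have hGc : HasCompactSupport fun x => h (w x) * ζ x := hζc.mul_left
  obtain ⟨D', hD'⟩ := hG.lipschitzWith_of_hasCompactSupport hGc one_ne_zero
  have by_parts := hη.integral_lineDeriv_mul_eq (μ := μ) hD' hGc v
  have lineDeriv_eq : ∀ x, lineDeriv ℝ (fun x => h (w x) * ζ x) x (-v) =
      -(deriv h (w x) * fderiv ℝ w x v * ζ x + h (w x) * fderiv ℝ ζ x v) := fun x => by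
    have h1 : HasFDerivAt (fun x => h (w x)) (deriv h (w x) • fderiv ℝ w x) x :=
      (hh.differentiable one_ne_zero _).hasDerivAt.comp_hasFDerivAt x
        (hw.differentiable one_ne_zero x).hasFDerivAt
    have h2 := h1.mul (hζ.differentiable one_ne_zero x).hasFDerivAt
    rw [(hG.differentiable one_ne_zero x).lineDeriv_eq_fderiv, map_neg,
      show fderiv ℝ (fun x => h (w x) * ζ x) x = _ from h2.fderiv]
    simp only [_root_.add_apply, _root_.smul_apply, smul_eq_mul]
    ring
  have hint_ζ : Integrable (fun x => h (w x) * (η x * fderiv ℝ ζ x v)) μ := by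
    refine Continuous.integrable_of_hasCompactSupport ((hh.continuous.comp hw.continuous).mul
      (hη.continuous.mul ((hζ.continuous_fderiv one_ne_zero).clm_apply continuous_const))) ?_
    exact (hζc.fderiv_apply ℝ v).mul_left.mul_left
  have hint_w : Integrable (fun x => deriv h (w x) * fderiv ℝ w x v * (η x * ζ x)) μ := by
    refine Continuous.integrable_of_hasCompactSupport ((((hh.continuous_deriv le_rfl).comp
      hw.continuous).mul ((hw.continuous_fderiv one_ne_zero).clm_apply continuous_const)).mul
        (hη.continuous.mul hζ.continuous)) ?_
    exact hζc.mul_left.mul_left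
  have expand : ∫ x, h (w x) * (lineDeriv ℝ η x v * ζ x) ∂μ =
      -(∫ x, deriv h (w x) * fderiv ℝ w x v * (η x * ζ x) ∂μ +
        ∫ x, h (w x) * (η x * fderiv ℝ ζ x v) ∂μ) := by
    simp_rw [mul_left_comm (h _) (lineDeriv ℝ η _ v), by_parts, lineDeriv_eq,
      ← integral_add hint_w hint_ζ, ← integral_neg]
    exact integral_congr_ae (Eventually.of_forall fun x => by ring)
  rw [expand]
  ring

/- The identity for smooth functions is applied to the mollifications of `U`. -/
theorem integral_comp_mul_lipschitz_mul_fderiv_of_mollify (hh : ContDiff ℝ 1 h)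
    (hη : LipschitzWith D η) (hζ : ContDiff ℝ 1 ζ) (hζc : HasCompactSupport ζ) (v : E)
    {U V : E → ℝ} (hU : Integrable U μ) (hV : Integrable V μ) {L : ℝ≥0} (hL : ∀ t, ‖deriv h t‖ ≤ L)
    (hUV : ∀ᶠ n in atTop, ∀ x ∈ tsupport ζ, fderiv ℝ (mollify μ U n) x v = mollify μ V n x) :
    ∫ x, h (U x) * (η x * fderiv ℝ ζ x v) ∂μ =
      -∫ x, (deriv h (U x) * V x * (η x * ζ x) + h (U x) * (lineDeriv ℝ η x v * ζ x)) ∂μ := by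
  have h_lipschitz : LipschitzWith L h := lipschitzWith_of_nnnorm_deriv_le
    (hh.differentiable one_ne_zero) hL
  have h'_cont : Continuous (deriv h) := hh.continuous_deriv le_rfl
  have cont₁ : Continuous fun x => η x * fderiv ℝ ζ x v := hη.continuous.mul
    ((hζ.continuous_fderiv one_ne_zero).clm_apply continuous_const)
  have supp₁ : HasCompactSupport fun x => η x * fderiv ℝ ζ x v := (hζc.fderiv_apply ℝ v).mul_left
  obtain ⟨B₁, hB₁⟩ := cont₁.bounded_above_of_compact_support supp₁
  have cont₂ : Continuous fun x => η x * ζ x := hη.continuous.mul hζ.continuous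
  obtain ⟨B₂, hB₂⟩ := cont₂.bounded_above_of_compact_support hζc.mul_left
  obtain ⟨B, hB⟩ := hζ.continuous.bounded_above_of_compact_support hζc
  have norm_lineDeriv : ∀ x, ‖lineDeriv ℝ η x v‖ ≤ D * ‖v‖ := fun x =>
    norm_lineDeriv_le_of_lipschitz ℝ hη
  have int₃ : Integrable (fun x => lineDeriv ℝ η x v * ζ x) μ :=
    (hζ.continuous.integrable_of_hasCompactSupport hζc).bdd_mul
      (hη.locallyIntegrable_lineDeriv v).aestronglyMeasurable (Eventually.of_forall norm_lineDeriv)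
  have hB₃ : ∀ x, ‖lineDeriv ℝ η x v * ζ x‖ ≤ D * ‖v‖ * B := fun x => by
    rw [norm_mul]; gcongr; exacts [norm_lineDeriv x, hB x]
  have lim₁ := tendsto_integral_lipschitz_comp_mul h_lipschitz hU (integrable_mollify μ hU)
    (tendsto_integral_abs_mollify_sub μ hU) (cont₁.integrable_of_hasCompactSupport supp₁) hB₁
  have lim₂ := tendsto_integral_bounded_comp_mul_mul h'_cont hL
    (fun n => (integrable_mollify μ hU n).aestronglyMeasurable) hV (integrable_mollify μ hV)
    (ae_tendsto_mollify μ hU) (tendsto_integral_abs_mollify_sub μ hV) cont₂.aestronglyMeasurable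
    hB₂
  have lim₃ := tendsto_integral_lipschitz_comp_mul h_lipschitz hU (integrable_mollify μ hU)
    (tendsto_integral_abs_mollify_sub μ hU) int₃ hB₃
  rw [integral_add (integrable_bounded_comp_mul_mul h'_cont hL hU.aestronglyMeasurable hV
    cont₂.aestronglyMeasurable hB₂) (integrable_lipschitz_comp_mul h_lipschitz hU int₃ hB₃)]
  refine tendsto_nhds_unique lim₁ ((lim₂.add lim₃).neg.congr' ?_)
  filter_upwards [hUV] with n hn
  rw [integral_comp_mul_lipschitz_mul_fderiv hh hη hζ hζc v
    ((contDiff_mollify μ hU.locallyIntegrable n).of_le (by simp))]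
  congr 2
  refine integral_congr_ae (Eventually.of_forall fun x => ?_)
  by_cases hx : x ∈ tsupport ζ
  · simp only [hn x hx]
  · simp only [image_eq_zero_of_notMem_tsupport hx, mul_zero]

theorem HasWeakDerivOn.comp_mul_lipschitz (hh : ContDiff ℝ 1 h) (hη : LipschitzWith D η)
    {Ω : Set E} (hΩ : IsOpen Ω) {v : E} {w g : E → ℝ}
    (hw : LocallyIntegrableOn w Ω μ) (hg : LocallyIntegrableOn g Ω μ)
    (hwg : HasWeakDerivOn μ Ω v w g) {L : ℝ≥0} (hL : ∀ t, ‖deriv h t‖ ≤ L) :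
    HasWeakDerivOn μ Ω v (fun y => h (w y) * η y)
      (fun y => deriv h (w y) * g y * η y + h (w y) * lineDeriv ℝ η y v) := by
  intro ζ hζ hζc hζΩ
  obtain ⟨δ, hδ, hδΩ⟩ := hζc.isCompact.exists_cthickening_subset_open hΩ hζΩ
  set K := Metric.cthickening δ (tsupport ζ)
  have K_compact : IsCompact K := hζc.isCompact.cthickening
  have K_meas : MeasurableSet K := K_compact.measurableSet
  have hwK := hw.integrableOn_compact_subset hδΩ K_compact
  have hgK := hg.integrableOn_compact_subset hδΩ K_compact
  have hUV : ∀ᶠ n in atTop, ∀ x ∈ tsupport ζ,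
      fderiv ℝ (mollify μ (K.indicator w) n) x v = mollify μ (K.indicator g) n x := by
    filter_upwards [(tendsto_rOut_shrinkingBump (E := E)).eventually (gt_mem_nhds hδ)] with n hn x
      hx
    exact hwg.fderiv_mollify K_meas hδΩ hwK ((Metric.closedBall_subset_closedBall hn.le).trans
      (Metric.closedBall_subset_cthickening hx δ))
  have eq_zero : ∀ x ∉ K, ζ x = 0 := fun x hx => image_eq_zero_of_notMem_tsupport fun hζx =>
    hx (Metric.self_subset_cthickening _ hζx)
  have fderiv_eq_zero : ∀ x ∉ K, fderiv ℝ ζ x v = 0 := fun x hx =>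
    fderiv_apply_eq_zero_of_notMem_tsupport (fun hζx => hx (Metric.self_subset_cthickening _ hζx))
      v
  rw [setIntegral_mul_eq_integral_indicator_mul hδΩ fderiv_eq_zero,
    setIntegral_mul_eq_integral_indicator_mul hδΩ eq_zero]
  convert integral_comp_mul_lipschitz_mul_fderiv_of_mollify hh hη (hζ.of_le (by simp)) hζc v
    ((integrable_indicator_iff K_meas).2 hwK) ((integrable_indicator_iff K_meas).2 hgK) hL hUV
    using 1
  · refine integral_congr_ae (Eventually.of_forall fun x => ?_)
    by_cases hx : x ∈ K
    · simp only [indicator_of_mem hx, mul_assoc]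
    · simp only [fderiv_eq_zero x hx, mul_zero]
  · refine congrArg Neg.neg (integral_congr_ae (Eventually.of_forall fun x => ?_))
    by_cases hx : x ∈ K
    · simp only [indicator_of_mem hx]; ring
    · simp only [eq_zero x hx, mul_zero, add_zero]

end WeakDerivative

section ProductRule

theorem exists_lipschitzWith_eventuallyEq {E : Type*} [PseudoMetricSpace E] [LocallyCompactSpace E]
    {Ω K : Set E} (hΩ : IsOpen Ω) (hK : IsCompact K) (hKΩ : K ⊆ Ω) {f : E → ℝ}
    (hf : LocallyLipschitzOn Ω f) :
    ∃ (g : E → ℝ) (D : ℝ≥0), LipschitzWith D g ∧ ∀ x ∈ K, f =ᶠ[𝓝 x] g := by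
  obtain ⟨K', hK', hKK', hK'Ω⟩ := exists_compact_between hK hΩ hKΩ
  obtain ⟨D, hD⟩ := (hf.mono hK'Ω).exists_lipschitzOnWith_of_compact hK'
  obtain ⟨g, hg, hfg⟩ := hD.extend_real
  exact ⟨g, D, hg, fun x hx => hfg.eventuallyEq_of_mem (mem_interior_iff_mem_nhds.1 (hKK' hx))⟩

theorem locallyIntegrableOn_lipschitz_comp {E : Type*} [TopologicalSpace E]
    [LocallyCompactSpace E] [MeasurableSpace E]
    {μ : Measure E} [IsFiniteMeasureOnCompacts μ] {Ω : Set E} (hΩ : IsLocallyClosed Ω)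
    {w : E → ℝ} (hw : LocallyIntegrableOn w Ω μ) {h : ℝ → ℝ} {L : ℝ≥0} (hh : LipschitzWith L h) :
    LocallyIntegrableOn (fun x => h (w x)) Ω μ := by
  rw [locallyIntegrableOn_iff hΩ] at hw ⊢
  intro K hKΩ hK
  have hone : IntegrableOn (fun _ => (1 : ℝ)) K μ := integrableOn_const hK.measure_lt_top.ne
  simpa [IntegrableOn] using integrable_lipschitz_comp_mul hh (hw K hKΩ hK) hone (B := 1) (by simp)

variable {m : ℕ} {M : Type*} [MetricSpace M] [ChartedSpace (EuclideanSpace ℝ (Fin m)) M]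
  [IsManifold (𝓡 m) ∞ M] [RiemannianBundle (fun x : M => TangentSpace (𝓡 m) x)]
  [IsContMDiffRiemannianBundle (𝓡 m) ∞ (EuclideanSpace ℝ (Fin m))
    (fun x : M => TangentSpace (𝓡 m) x)] [IsRiemannianManifold (𝓡 m) M]
  {e : OpenPartialHomeomorph M (EuclideanSpace ℝ (Fin m))} {η : M → ℝ}

theorem exists_lipschitzWith_eq_comp_symm (he : e ∈ IsManifold.maximalAtlas (𝓡 m) ∞ M)
    (hη : LocallyLipschitz η) {K : Set (EuclideanSpace ℝ (Fin m))} (hK : IsCompact K)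
    (hKe : K ⊆ e.target) :
    ∃ (g : EuclideanSpace ℝ (Fin m) → ℝ) (D : ℝ≥0), LipschitzWith D g ∧
      (∀ y ∈ K, g y = η (e.symm y)) ∧
      ∀ᵐ y, y ∈ K → ∀ v, lineDeriv ℝ g y v = ⟪grad m η (e.symm y), coordVector e y v⟫_ℝ := by
  have hηe : LocallyLipschitzOn e.target fun y => η (e.symm y) :=
    locallyLipschitzOn_iff_restrict.2 (hη.comp (locallyLipschitzOn_symm he).restrict)
  obtain ⟨g, D, hg, heq⟩ := exists_lipschitzWith_eventuallyEq e.open_target hK hKe hηe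
  refine ⟨g, D, hg, fun y hy => (heq y hy).self_of_nhds.symm, ?_⟩
  filter_upwards [hg.ae_differentiableAt] with y hy hyK v
  rw [inner_grad_coordVector he (hKe hyK) ((heq y hyK).differentiableAt_iff.2 hy),
    (heq y hyK).fderiv_eq, hy.lineDeriv_eq_fderiv]

variable {u : M → ℝ} {X : (x : M) → TangentSpace (𝓡 m) x} {h : ℝ → ℝ} {L : ℝ≥0}

theorem IsWeakGradient.locallyIntegrableOn_inner_comp_mul (hu : IsWeakGradient u X)
    (hh : ContDiff ℝ 1 h) (hL : ∀ t, ‖deriv h t‖ ≤ L) (hη : LocallyLipschitz η)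
    (he : e ∈ IsManifold.maximalAtlas (𝓡 m) ∞ M) (v : EuclideanSpace ℝ (Fin m)) :
    LocallyIntegrableOn (fun y => deriv h (u (e.symm y)) * ⟪X (e.symm y), coordVector e y v⟫_ℝ *
      η (e.symm y) + h (u (e.symm y)) * ⟪grad m η (e.symm y), coordVector e y v⟫_ℝ)
      e.target := by
  have hhu := locallyIntegrableOn_lipschitz_comp e.open_target.isLocallyClosed
    (hu.locallyIntegrable e he)
    (lipschitzWith_of_nnnorm_deriv_le (hh.differentiable one_ne_zero) hL)
  rw [locallyIntegrableOn_iff e.open_target.isLocallyClosed]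
  intro K hKe hK
  obtain ⟨g, D, hg, hgη, hgrad⟩ := exists_lipschitzWith_eq_comp_symm he hη hK hKe
  have int₁ : IntegrableOn (fun y => deriv h (u (e.symm y)) *
      ⟪X (e.symm y), coordVector e y v⟫_ℝ * g y) K := by
    refine IntegrableOn.mul_continuousOn ?_ hg.continuous.continuousOn hK
    exact ((hu.locallyIntegrable_grad e he v).integrableOn_compact_subset hKe hK).bdd_mul (c := L)
      ((hh.continuous_deriv le_rfl).comp_aestronglyMeasurable
        ((hu.locallyIntegrable e he).integrableOn_compact_subset hKe hK).aestronglyMeasurable)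
      (Eventually.of_forall fun y => hL _)
  have int₂ : IntegrableOn (fun y => h (u (e.symm y)) * lineDeriv ℝ g y v) K :=
    (hhu.integrableOn_compact_subset hKe hK).mul_bdd (c := D * ‖v‖)
      (hg.locallyIntegrable_lineDeriv v).aestronglyMeasurable.restrict
      (Eventually.of_forall fun y => norm_lineDeriv_le_of_lipschitz ℝ hg)
  refine (int₁.add int₂).congr ?_
  filter_upwards [ae_restrict_mem hK.measurableSet, ae_restrict_of_ae hgrad] with y hy hgrad_y
  rw [Pi.add_apply, hgrad_y hy, hgη y hy]

theorem IsWeakGradient.comp_mul (hu : IsWeakGradient u X) (hh : ContDiff ℝ 1 h)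
    (hL : ∀ t, ‖deriv h t‖ ≤ L) (hη : LocallyLipschitz η) :
    IsWeakGradient (fun x => h (u x) * η x)
      (fun x => (deriv h (u x) * η x) • X x + h (u x) • grad m η x) := by
  have inner_eq : ∀ x v, ⟪(deriv h (u x) * η x) • X x + h (u x) • grad m η x, v⟫_ℝ =
      deriv h (u x) * ⟪X x, v⟫_ℝ * η x + h (u x) * ⟪grad m η x, v⟫_ℝ := fun x v => by
    rw [inner_add_left, real_inner_smul_left, real_inner_smul_left, mul_right_comm]
  refine ⟨fun e he => ?_, fun e he v => ?_, fun e he v ζ hζ hζc hζe => ?_⟩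
  · exact (locallyIntegrableOn_lipschitz_comp e.open_target.isLocallyClosed
      (hu.locallyIntegrable e he)
      (lipschitzWith_of_nnnorm_deriv_le (hh.differentiable one_ne_zero) hL)).mul_continuousOn
      (hη.continuous.comp_continuousOn e.continuousOn_symm) e.open_target.isLocallyClosed
  · simpa only [inner_eq] using hu.locallyIntegrableOn_inner_comp_mul hh hL hη he v
  · obtain ⟨g, D, hg, hgη, hgrad⟩ := exists_lipschitzWith_eq_comp_symm he hη hζc.isCompact hζe
    have weak_deriv := HasWeakDerivOn.comp_mul_lipschitz hh hg e.open_target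
      (hu.locallyIntegrable e he) (hu.locallyIntegrable_grad e he v) (hu.integral_eq e he v)
      hL ζ hζ hζc hζe
    simp only [inner_eq]
    convert weak_deriv using 1
    · refine integral_congr_ae (Eventually.of_forall fun y => ?_)
      by_cases hy : y ∈ tsupport ζ
      · simp only [hgη y hy]
      · simp only [fderiv_apply_eq_zero_of_notMem_tsupport hy, mul_zero]
    · refine congrArg Neg.neg (integral_congr_ae (ae_restrict_of_ae ?_))
      filter_upwards [hgrad] with y hgrad_y
      by_cases hy : y ∈ tsupport ζ
      · rw [hgrad_y hy, hgη y hy]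
      · simp only [image_eq_zero_of_notMem_tsupport hy, mul_zero]

end ProductRule

theorem aemeasurable_comp_of_ae_continuous {α ι β : Type*} [MeasurableSpace α] {μ : Measure α}
    [TopologicalSpace ι] [TopologicalSpace.PseudoMetrizableSpace ι] [SecondCountableTopology ι]
    [MeasurableSpace ι] [BorelSpace ι]
    [TopologicalSpace β] [TopologicalSpace.PseudoMetrizableSpace β] [MeasurableSpace β]
    [BorelSpace β] {F : α → ι → β} (hF : ∀ i, AEMeasurable (fun x => F x i) μ)
    (hc : ∀ᵐ x ∂μ, Continuous (F x)) {s : α → ι} (hs : AEMeasurable s μ) :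
    AEMeasurable (fun x => F x (s x)) μ := by
  have hs' : StronglyMeasurable (hs.mk s) := hs.measurable_mk.stronglyMeasurable
  have approx : ∀ n, AEMeasurable (fun x => F x (hs'.approx n x)) μ := fun n => by
    refine ⟨fun x => (hF (hs'.approx n x)).mk _ x, SimpleFunc.measurable_bind (hs'.approx n)
      (fun i x => (hF i).mk _ x) fun i => (hF i).measurable_mk, ?_⟩
    have h : ∀ᵐ x ∂μ, ∀ i ∈ (hs'.approx n).range, F x i = (hF i).mk _ x :=
      (ae_ball_iff (Finset.countable_toSet _)).2 fun i _ => (hF i).ae_eq_mk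
    filter_upwards [h] with x hx using hx _ (SimpleFunc.mem_range_self _ x)
  have lim : AEMeasurable (fun x => F x (hs.mk s x)) μ := by
    refine aemeasurable_of_tendsto_metrizable_ae atTop approx ?_
    filter_upwards [hc] with x hx using (hx.tendsto _).comp (hs'.tendsto_approx x)
  refine lim.congr ?_
  filter_upwards [hs.ae_eq_mk] with x hx
  rw [hx]

section Volume

variable {m : ℕ} {M : Type*} [TopologicalSpace M] [MeasurableSpace M]
  {e : OpenPartialHomeomorph M (EuclideanSpace ℝ (Fin m))}

theorem measurableSet_source_inter_preimage [OpensMeasurableSpace M]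
    (e : OpenPartialHomeomorph M (EuclideanSpace ℝ (Fin m)))
    {B : Set (EuclideanSpace ℝ (Fin m))} (hB : MeasurableSet B) :
    MeasurableSet (e.source ∩ e ⁻¹' B) := by
  have h := e.open_source.measurableSet.subtype_image
    ((continuousOn_iff_continuous_domRestrict.1 e.continuousOn).measurable hB)
  convert h using 1
  ext x
  simp [and_comm]

variable [ChartedSpace (EuclideanSpace ℝ (Fin m)) M]
  [RiemannianBundle (fun x : M => TangentSpace (𝓡 m) x)]

theorem riemannianVolume_eq_zero {N : Set M} (hN : MeasurableSet N)
    (h : ∀ e ∈ IsManifold.maximalAtlas (𝓡 m) ∞ M, chartVolume e N = 0) :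
    riemannianVolume m M N = 0 := by
  have hle : riemannianVolume m M ≤ (⊤ : Measure M).restrict Nᶜ := by
    refine iSup₂_le fun e he => ?_
    rw [← Measure.restrict_eq_self_of_ae_mem (μ := chartVolume e) (s := Nᶜ)
      (measure_eq_zero_iff_ae_notMem.1 (h e he))]
    exact Measure.restrict_mono le_rfl le_top
  refine le_antisymm ((hle N).trans ?_) zero_le
  simp [Measure.restrict_apply hN]

theorem chartVolume_eq_zero {N : Set M} (hN : MeasurableSet N)
    (h : volume (e.target ∩ e.symm ⁻¹' N) = 0) : chartVolume e N = 0 := by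
  rw [chartVolume]
  set ν := (volume.restrict e.target).withDensity
    fun y => ENNReal.ofReal √(gramMatrix e y).det
  by_cases hm : AEMeasurable e.symm ν
  · rw [Measure.map_apply_of_aemeasurable hm hN]
    refine withDensity_absolutelyContinuous _ _ ?_
    rwa [Measure.restrict_apply₀' e.open_target.measurableSet.nullMeasurableSet, inter_comm]
  · rw [Measure.map_of_not_aemeasurable hm]
    rfl

variable [OpensMeasurableSpace M]

/- In another chart the set is the image of a null set under a transition map, which is
differentiable. -/
theorem riemannianVolume_source_inter_preimage_eq_zero
    (he : e ∈ IsManifold.maximalAtlas (𝓡 m) ∞ M) {B : Set (EuclideanSpace ℝ (Fin m))}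
    (hB : volume B = 0) : riemannianVolume m M (e.source ∩ e ⁻¹' B) = 0 := by
  set B' := toMeasurable volume B
  have hB' : volume B' = 0 := (measure_toMeasurable B).trans hB
  refine measure_mono_null (t := e.source ∩ e ⁻¹' B')
    (inter_subset_inter_right _ (preimage_mono (subset_toMeasurable _ _))) ?_
  have hN := measurableSet_source_inter_preimage e (measurableSet_toMeasurable volume B)
  refine riemannianVolume_eq_zero hN fun e' he' => chartVolume_eq_zero hN ?_
  have transition : DifferentiableOn ℝ (fun y => e' (e.symm y))
      (B' ∩ (e.target ∩ e.symm ⁻¹' e'.source)) := fun y hy =>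
    (((mdifferentiable_of_mem_maximalAtlas he').mdifferentiableAt hy.2.2).comp y
      ((mdifferentiable_of_mem_maximalAtlas he).mdifferentiableAt_symm
        hy.2.1)).differentiableAt.differentiableWithinAt
  refine measure_mono_null ?_ (addHaar_image_eq_zero_of_differentiableOn_of_addHaar_eq_zero volume
    transition (measure_mono_null inter_subset_left hB'))
  rintro z ⟨hz, hz_source, hz_mem⟩
  refine ⟨e (e'.symm z), ⟨hz_mem, e.map_source hz_source, ?_⟩, ?_⟩
  · rw [mem_preimage, e.left_inv hz_source]
    exact e'.map_target hz
  · simp only [e.left_inv hz_source, e'.right_inv hz]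

theorem aemeasurable_restrict_source (he : e ∈ IsManifold.maximalAtlas (𝓡 m) ∞ M) {F : M → ℝ}
    (hF : AEMeasurable (fun y => F (e.symm y)) (volume.restrict e.target)) :
    AEMeasurable F ((riemannianVolume m M).restrict e.source) := by
  have hmk : AEMeasurable (fun x => hF.mk _ (e x)) ((riemannianVolume m M).restrict e.source) :=
    hF.measurable_mk.comp_aemeasurable
      (e.continuousOn.aemeasurable e.open_source.measurableSet)
  refine hmk.congr (EventuallyEq.symm ?_)
  have eq_mk : ∀ᵐ y ∂volume, y ∈ e.target → F (e.symm y) = hF.mk _ y :=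
    (ae_restrict_iff' e.open_target.measurableSet).1 hF.ae_eq_mk
  rw [EventuallyEq, ae_restrict_iff' e.open_source.measurableSet, ae_iff]
  refine measure_mono_null (fun x hx => ?_)
    (riemannianVolume_source_inter_preimage_eq_zero he (ae_iff.1 eq_mk))
  simp only [Classical.not_imp, mem_ofPred_eq, mem_inter_iff, mem_preimage] at hx ⊢
  exact ⟨hx.1, e.map_source hx.1, by rw [e.left_inv hx.1]; exact hx.2⟩

theorem aemeasurable_riemannianVolume [IsManifold (𝓡 m) ∞ M] [SecondCountableTopology M] {F : M → ℝ}
    (h : ∀ e ∈ IsManifold.maximalAtlas (𝓡 m) ∞ M,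
      AEMeasurable (fun y => F (e.symm y)) (volume.restrict e.target)) :
    AEMeasurable F (riemannianVolume m M) := by
  obtain ⟨s, hs, hcov⟩ := TopologicalSpace.countable_cover_nhds
    (f := fun x : M => (chartAt (EuclideanSpace ℝ (Fin m)) x).source)
    (fun x => (chartAt (EuclideanSpace ℝ (Fin m)) x).open_source.mem_nhds (mem_chart_source _ x))
  have := hs.to_subtype
  rw [biUnion_eq_iUnion] at hcov
  rw [← Measure.restrict_univ (μ := riemannianVolume m M), ← hcov, aemeasurable_iUnion_iff]
  exact fun x => aemeasurable_restrict_source (IsManifold.chart_mem_maximalAtlas x.1)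
    (h _ (IsManifold.chart_mem_maximalAtlas x.1))

end Volume

section ChartMeasurable

variable {m : ℕ} {M : Type*} [TopologicalSpace M] [ChartedSpace (EuclideanSpace ℝ (Fin m)) M]
  [RiemannianBundle (fun x : M => TangentSpace (𝓡 m) x)]
  {u : M → ℝ} {X Y : (x : M) → TangentSpace (𝓡 m) x}
  {e : OpenPartialHomeomorph M (EuclideanSpace ℝ (Fin m))}

/-- Measurability of a vector field, phrased as the measurability of its covariant components
`⟨X, ∂/∂yⁱ⟩` in every chart. -/
def IsChartMeasurable (X : (x : M) → TangentSpace (𝓡 m) x) : Prop :=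
  ∀ e ∈ IsManifold.maximalAtlas (𝓡 m) ∞ M, ∀ v : EuclideanSpace ℝ (Fin m),
    AEMeasurable (fun y => ⟪X (e.symm y), coordVector e y v⟫_ℝ) (volume.restrict e.target)

theorem IsWeakGradient.isChartMeasurable (h : IsWeakGradient u X) : IsChartMeasurable X :=
  fun e he v => (h.locallyIntegrable_grad e he v).aestronglyMeasurable.aemeasurable

theorem IsWeakGradient.aemeasurable_comp_symm (h : IsWeakGradient u X)
    (he : e ∈ IsManifold.maximalAtlas (𝓡 m) ∞ M) :
    AEMeasurable (fun y => u (e.symm y)) (volume.restrict e.target) :=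
  (h.locallyIntegrable e he).aestronglyMeasurable.aemeasurable

theorem IsWeakGradient.aemeasurable [IsManifold (𝓡 m) ∞ M] [MeasurableSpace M]
    [OpensMeasurableSpace M] [SecondCountableTopology M] (h : IsWeakGradient u X) :
    AEMeasurable u (riemannianVolume m M) :=
  aemeasurable_riemannianVolume fun _ => h.aemeasurable_comp_symm

theorem inner_coordVector_eq_sum (e : OpenPartialHomeomorph M (EuclideanSpace ℝ (Fin m)))
    (y v : EuclideanSpace ℝ (Fin m)) (ξ : TangentSpace (𝓡 m) (e.symm y)) :
    ⟪coordVector e y v, ξ⟫_ℝ = ∑ i, v i * ⟪coordVector e y (EuclideanSpace.single i 1), ξ⟫_ℝ := by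
  rw [coordVector_eq_sum, sum_inner]
  exact Finset.sum_congr rfl fun i _ => real_inner_smul_left _ _ _

theorem gramMatrix_mulVec (e : OpenPartialHomeomorph M (EuclideanSpace ℝ (Fin m)))
    (y v : EuclideanSpace ℝ (Fin m)) :
    (gramMatrix e y).mulVec v =
      fun i => ⟪coordVector e y v, coordVector e y (EuclideanSpace.single i 1)⟫_ℝ := by
  ext i
  rw [inner_coordVector_eq_sum]
  simp only [Matrix.mulVec, dotProduct, gramMatrix, Matrix.of_apply]
  exact Finset.sum_congr rfl fun j _ => by rw [real_inner_comm, mul_comm]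

theorem isUnit_gramMatrix (he : e ∈ IsManifold.maximalAtlas (𝓡 m) ∞ M)
    {y : EuclideanSpace ℝ (Fin m)} (hy : y ∈ e.target) : IsUnit (gramMatrix e y) := by
  rw [← Matrix.mulVec_injective_iff_isUnit]
  refine (injective_iff_map_eq_zero (Matrix.mulVecLin (gramMatrix e y))).2 fun c hc => ?_
  set v : EuclideanSpace ℝ (Fin m) := WithLp.toLp 2 c
  have inner_eq_zero : ∀ i,
      ⟪coordVector e y v, coordVector e y (EuclideanSpace.single i 1)⟫_ℝ = 0 :=
    congr_fun ((gramMatrix_mulVec e y v).symm.trans hc)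
  have coordVector_eq_zero : coordVector e y v = 0 := by
    rw [← inner_self_eq_zero (𝕜 := ℝ), inner_coordVector_eq_sum]
    refine Finset.sum_eq_zero fun i _ => ?_
    rw [real_inner_comm, inner_eq_zero, mul_zero]
  have v_eq_zero : v = 0 := by
    rw [← chartComponents_coordVector he hy v, coordVector_eq_zero]
    exact map_zero (mfderiv (𝓡 m) (𝓡 m) e (e.symm y))
  exact congr_arg WithLp.ofLp v_eq_zero

theorem chartComponents_eq_toLp_mulVec (he : e ∈ IsManifold.maximalAtlas (𝓡 m) ∞ M)
    {y : EuclideanSpace ℝ (Fin m)} (hy : y ∈ e.target) (ξ : TangentSpace (𝓡 m) (e.symm y)) :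
    chartComponents e y ξ = WithLp.toLp 2 ((gramMatrix e y)⁻¹.mulVec
      fun i => ⟪ξ, coordVector e y (EuclideanSpace.single i 1)⟫_ℝ) := by
  have gram_mul := gramMatrix_mulVec e y (chartComponents e y ξ)
  rw [coordVector_chartComponents he hy] at gram_mul
  rw [← gram_mul, Matrix.mulVec_mulVec, Matrix.nonsing_inv_mul _
    ((Matrix.isUnit_iff_isUnit_det _).1 (isUnit_gramMatrix he hy)), Matrix.one_mulVec]

theorem aemeasurable_inner_of_chartComponents (he : e ∈ IsManifold.maximalAtlas (𝓡 m) ∞ M)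
    {W Z : (y : EuclideanSpace ℝ (Fin m)) → TangentSpace (𝓡 m) (e.symm y)}
    (hW : AEMeasurable (fun y => chartComponents e y (W y)) (volume.restrict e.target))
    (hZ : ∀ v, AEMeasurable (fun y => ⟪Z y, coordVector e y v⟫_ℝ) (volume.restrict e.target)) :
    AEMeasurable (fun y => ⟪W y, Z y⟫_ℝ) (volume.restrict e.target) := by
  have hsum : AEMeasurable (fun y => ∑ i, chartComponents e y (W y) i *
      ⟪coordVector e y (EuclideanSpace.single i 1), Z y⟫_ℝ) (volume.restrict e.target) := by
    refine Finset.aemeasurable_fun_sum _ fun i _ => AEMeasurable.mul ?_ ?_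
    · exact (EuclideanSpace.proj (𝕜 := ℝ) i).measurable.comp_aemeasurable hW
    · exact (hZ _).congr (Eventually.of_forall fun y => real_inner_comm _ _)
  refine hsum.congr ?_
  filter_upwards [ae_restrict_mem e.open_target.measurableSet] with y hy
  rw [← inner_coordVector_eq_sum, coordVector_chartComponents he hy]

variable [IsManifold (𝓡 m) ∞ M] [IsContMDiffRiemannianBundle (𝓡 m) ∞ (EuclideanSpace ℝ (Fin m))
    (fun x : M => TangentSpace (𝓡 m) x)]

theorem continuousOn_gramMatrix_inv (he : e ∈ IsManifold.maximalAtlas (𝓡 m) ∞ M) :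
    ContinuousOn (fun y => (gramMatrix e y)⁻¹) e.target := by
  have hg : ContinuousOn (gramMatrix e) e.target :=
    continuousOn_pi.2 fun i => continuousOn_pi.2 fun j => continuousOn_inner_coordVector he _ _
  have hdet : ContinuousOn (fun y => ((gramMatrix e y).det)⁻¹) e.target :=
    ((continuous_id.matrix_det).comp_continuousOn hg).inv₀ fun y hy =>
      ((Matrix.isUnit_iff_isUnit_det _).1 (isUnit_gramMatrix he hy)).ne_zero
  have hadj : ContinuousOn (fun y => (gramMatrix e y).adjugate) e.target :=
    (continuous_id.matrix_adjugate).comp_continuousOn hg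
  refine (hdet.smul hadj).congr fun y _ => ?_
  rw [Matrix.inv_def, Ring.inverse_eq_inv']
  rfl

theorem IsChartMeasurable.aemeasurable_chartComponents (hX : IsChartMeasurable X)
    (he : e ∈ IsManifold.maximalAtlas (𝓡 m) ∞ M) :
    AEMeasurable (fun y => chartComponents e y (X (e.symm y))) (volume.restrict e.target) := by
  have entries : ∀ i, AEMeasurable (fun y => ∑ j, (gramMatrix e y)⁻¹ i j *
      ⟪X (e.symm y), coordVector e y (EuclideanSpace.single j 1)⟫_ℝ)
      (volume.restrict e.target) := fun i => by
    refine Finset.aemeasurable_fun_sum _ fun j _ => AEMeasurable.mul ?_ (hX e he _)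
    exact ((continuous_apply_apply i j).comp_continuousOn
      (continuousOn_gramMatrix_inv he)).aemeasurable e.open_target.measurableSet
  refine ((WithLp.measurable_toLp 2 (Fin m → ℝ)).comp_aemeasurable
    (aemeasurable_pi_lambda _ entries)).congr ?_
  filter_upwards [ae_restrict_mem e.open_target.measurableSet] with y hy
  exact (chartComponents_eq_toLp_mulVec he hy _).symm

theorem IsCaratheodory.isChartMeasurable
    {A : (x : M) → ℝ → TangentSpace (𝓡 m) x → TangentSpace (𝓡 m) x} (hA : IsCaratheodory A)
    (hu : ∀ e ∈ IsManifold.maximalAtlas (𝓡 m) ∞ M,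
      AEMeasurable (fun y => u (e.symm y)) (volume.restrict e.target))
    (hX : IsChartMeasurable X) : IsChartMeasurable fun x => A x (u x) (X x) := by
  intro e he v
  have localRep_meas : AEMeasurable (fun y => localRep A e y (u (e.symm y))
      (chartComponents e y (X (e.symm y)))) (volume.restrict e.target) :=
    aemeasurable_comp_of_ae_continuous
      (F := fun y (z : ℝ × EuclideanSpace ℝ (Fin m)) => localRep A e y z.1 z.2)
      (fun z => hA.measurable e he z.1 z.2) (hA.continuous e he)
      ((hu e he).prodMk (hX.aemeasurable_chartComponents he))
  refine aemeasurable_inner_of_chartComponents he (localRep_meas.congr ?_) fun w =>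
    (continuousOn_inner_coordVector he _ _).aemeasurable e.open_target.measurableSet
  filter_upwards [ae_restrict_mem e.open_target.measurableSet] with y hy
  rw [localRep, coordVector_chartComponents he hy]

variable [MeasurableSpace M] [OpensMeasurableSpace M] [SecondCountableTopology M]

theorem IsChartMeasurable.aemeasurable_inner (hX : IsChartMeasurable X)
    (hY : IsChartMeasurable Y) : AEMeasurable (fun x => ⟪X x, Y x⟫_ℝ) (riemannianVolume m M) :=
  aemeasurable_riemannianVolume fun e he =>
    aemeasurable_inner_of_chartComponents he (hX.aemeasurable_chartComponents he) (hY e he)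

theorem IsChartMeasurable.aemeasurable_norm (hX : IsChartMeasurable X) :
    AEMeasurable (fun x => ‖X x‖) (riemannianVolume m M) := by
  simp_rw [norm_eq_sqrt_real_inner]
  exact Real.continuous_sqrt.measurable.comp_aemeasurable (hX.aemeasurable_inner hX)

end ChartMeasurable

section Elementary

theorem rpow_le_add_rpow_of_mem_uIcc {a b x : ℝ} (s : ℝ) (ha : 0 < a) (hb : 0 < b)
    (hx : x ∈ uIcc a b) : x ^ s ≤ a ^ s + b ^ s := by
  wlog hab : a ≤ b generalizing a b
  · rw [add_comm]
    exact this hb ha (uIcc_comm a b ▸ hx) (le_of_not_ge hab)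
  rw [uIcc_of_le hab] at hx
  have hx0 : 0 < x := ha.trans_le hx.1
  rcases le_total 0 s with hs | hs
  · exact (Real.rpow_le_rpow hx0.le hx.2 hs).trans (le_add_of_nonneg_left (by positivity))
  · exact (Real.rpow_le_rpow_of_nonpos ha hx.1 hs).trans (le_add_of_nonneg_right (by positivity))

theorem abs_rpow_sub_two_mul_mul_self {p : ℝ} (hp : 0 < p) (t : ℝ) :
    |t| ^ (p - 2) * t * t = |t| ^ p := by
  rcases eq_or_ne t 0 with rfl | ht
  · simp [Real.zero_rpow hp.ne']
  rw [mul_assoc, ← abs_mul_abs_self, ← mul_assoc, ← Real.rpow_add_one (abs_ne_zero.2 ht),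
    ← Real.rpow_add_one (abs_ne_zero.2 ht)]
  ring_nf

theorem rpow_sub_one_mul_le_add {p η x y : ℝ} (hp : 1 < p) (hη : 0 < η) (hx : 0 ≤ x)
    (hy : 0 ≤ y) :
    x ^ (p - 1) * y ≤ η * x ^ p + (p - 1) ^ (p - 1) / p ^ p * η ^ (1 - p) * y ^ p := by
  have hp0 : 0 < p := by linarith
  have hp1 : 0 < p - 1 := by linarith
  set p' := p / (p - 1) with hp'
  have hp'0 : 0 < p' := by positivity
  set N := (p' * η) ^ ((p - 1) / p) with hN
  have hN0 : 0 < N := by positivity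
  have hNx : (N * x ^ (p - 1)) ^ p' / p' = η * x ^ p := by
    rw [Real.mul_rpow hN0.le (by positivity), hN, ← Real.rpow_mul (by positivity),
      ← Real.rpow_mul hx, show (p - 1) / p * p' = 1 by rw [hp']; field_simp,
      show (p - 1) * p' = p by rw [hp']; field_simp, Real.rpow_one]
    field_simp
  have hyN : (y / N) ^ p / p = (p - 1) ^ (p - 1) / p ^ p * η ^ (1 - p) * y ^ p := by
    have hpp : p ^ p = p ^ (p - 1) * p := by rw [← Real.rpow_add_one hp0.ne', sub_add_cancel]
    rw [Real.div_rpow hy hN0.le, hN, ← Real.rpow_mul (by positivity), div_mul_cancel₀ _ hp0.ne',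
      Real.mul_rpow hp'0.le hη.le, hp', Real.div_rpow hp0.le hp1.le, ← neg_sub p 1,
      Real.rpow_neg hη.le, hpp]
    field_simp
  calc x ^ (p - 1) * y = N * x ^ (p - 1) * (y / N) := by field_simp
    _ ≤ (N * x ^ (p - 1)) ^ p' / p' + (y / N) ^ p / p :=
      Real.young_inequality_of_nonneg (by positivity) (by positivity)
        (Real.HolderConjugate.conjExponent hp).symm
    _ = _ := by rw [hNx, hyN]

theorem add_rpow_le_weighted {p τ a b : ℝ} (hp : 1 ≤ p) (hτ : τ ∈ Ioo 0 1) (ha : 0 ≤ a)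
    (hb : 0 ≤ b) : (a + b) ^ p ≤ (1 - τ) ^ (1 - p) * a ^ p + τ ^ (1 - p) * b ^ p := by
  have hτ0 : 0 < τ := hτ.1
  have hτ1 : 0 < 1 - τ := sub_pos.2 hτ.2
  have hconv := (convexOn_rpow hp).2 (x := a / (1 - τ)) (y := b / τ)
    (div_nonneg ha hτ1.le) (div_nonneg hb hτ0.le) hτ1.le hτ0.le (by ring)
  simp only [smul_eq_mul, mul_div_cancel₀ _ hτ1.ne', mul_div_cancel₀ _ hτ0.ne'] at hconv
  refine hconv.trans_eq ?_
  rw [Real.div_rpow ha hτ1.le, Real.div_rpow hb hτ0.le, Real.rpow_sub hτ1, Real.rpow_sub hτ0,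
    Real.rpow_one, Real.rpow_one]
  field_simp

theorem exists_mul_one_sub_rpow_lt_one (p : ℝ) {κ : ℝ} (hκ : κ < 1) :
    ∃ τ ∈ Ioo (0 : ℝ) 1, κ * (1 - τ) ^ (1 - p) < 1 := by
  have hlim : Tendsto (fun τ : ℝ => κ * (1 - τ) ^ (1 - p)) (𝓝 0) (𝓝 κ) := by
    have hbase : Tendsto (fun τ : ℝ => 1 - τ) (𝓝 0) (𝓝 1) := by
      simpa using (continuous_sub_left (1 : ℝ)).tendsto 0
    simpa using (hbase.rpow_const (p := 1 - p) (Or.inl one_ne_zero)).const_mul κ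
  obtain ⟨τ, hlt, hτ⟩ := ((hlim.eventually_lt_const hκ).filter_mono nhdsWithin_le_nhds |>.and
    (Ioo_mem_nhdsGT one_pos)).exists
  exact ⟨τ, hτ, hlt⟩

end Elementary

section Cutoff

variable {p c R R' s : ℝ}

theorem hasDerivAt_max_zero_rpow (hp : 1 < p) (x : ℝ) :
    HasDerivAt (fun x => max x 0 ^ p) (p * max x 0 ^ (p - 1)) x := by
  have hp0 : 0 < p := by linarith
  rcases lt_trichotomy x 0 with hx | rfl | hx
  · rw [max_eq_right hx.le, Real.zero_rpow (by linarith), mul_zero]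
    refine (hasDerivAt_const x (0 : ℝ)).congr_of_eventuallyEq ?_
    filter_upwards [Iio_mem_nhds hx] with y hy
    rw [max_eq_right (le_of_lt hy), Real.zero_rpow hp0.ne']
  · have habs := hasDerivAt_abs_rpow 0 hp
    rw [mul_zero, hasDerivAt_iff_isLittleO] at habs
    rw [max_self, Real.zero_rpow (by linarith), mul_zero, hasDerivAt_iff_isLittleO]
    refine (Asymptotics.isBigO_of_le _ fun y => ?_).trans_isLittleO habs
    simp only [max_self, Real.zero_rpow hp0.ne', abs_zero, smul_zero, sub_zero]
    rw [Real.norm_of_nonneg (by positivity), Real.norm_of_nonneg (by positivity)]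
    exact Real.rpow_le_rpow (le_max_right _ _) (max_le (le_abs_self y) (abs_nonneg y)) hp0.le
  · rw [max_eq_left hx.le]
    refine (Real.hasDerivAt_rpow_const (Or.inl hx.ne')).congr_of_eventuallyEq ?_
    filter_upwards [Ioi_mem_nhds hx] with y hy
    rw [max_eq_left (le_of_lt hy)]

/-- The `p`-th root `(e^{-cs/p} - e^{-cR/p})₊` of the radial cut-off. -/
def cutoffRoot (p c R s : ℝ) : ℝ :=
  max (Real.exp (-c * s / p) - Real.exp (-c * R / p)) 0

/-- A cut-off supported in `s ≤ R` which behaves like `e^{-cs}` for `s` far below `R`. As a `p`-th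
power it is of class `C¹` and its derivative can be absorbed by Young's inequality. -/
def cutoff (p c R s : ℝ) : ℝ :=
  cutoffRoot p c R s ^ p

theorem cutoffRoot_nonneg : 0 ≤ cutoffRoot p c R s :=
  le_max_right _ _

theorem cutoff_nonneg : 0 ≤ cutoff p c R s :=
  Real.rpow_nonneg cutoffRoot_nonneg p

theorem exp_neg_mul_div_le (hp : 0 < p) (hc : 0 < c) (hs : R ≤ s) :
    Real.exp (-c * s / p) ≤ Real.exp (-c * R / p) := by
  rw [Real.exp_le_exp, div_le_div_iff_of_pos_right hp]
  nlinarith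

theorem exp_neg_mul_div_rpow (hp : 0 < p) : Real.exp (-c * s / p) ^ p = Real.exp (-c * s) := by
  rw [← Real.exp_mul, div_mul_cancel₀ _ hp.ne']

theorem cutoffRoot_eq_zero (hp : 0 < p) (hc : 0 < c) (hs : R ≤ s) : cutoffRoot p c R s = 0 :=
  max_eq_right (sub_nonpos.2 (exp_neg_mul_div_le hp hc hs))

theorem cutoff_eq_zero (hp : 0 < p) (hc : 0 < c) (hs : R ≤ s) : cutoff p c R s = 0 := by
  rw [cutoff, cutoffRoot_eq_zero hp hc hs, Real.zero_rpow hp.ne']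

theorem cutoff_pos (hp : 0 < p) (hc : 0 < c) (hs : s < R) : 0 < cutoff p c R s := by
  refine Real.rpow_pos_of_pos (lt_max_of_lt_left (sub_pos.2 (Real.exp_lt_exp.2 ?_))) p
  rw [div_lt_div_iff_of_pos_right hp]
  nlinarith

theorem cutoff_mono (hp : 0 < p) (hc : 0 < c) (hR : R ≤ R') : cutoff p c R s ≤ cutoff p c R' s :=
  Real.rpow_le_rpow cutoffRoot_nonneg
    (max_le_max_right 0 (sub_le_sub_left (exp_neg_mul_div_le hp hc hR) _)) hp.le

theorem cutoff_le_exp (hp : 0 < p) : cutoff p c R s ≤ Real.exp (-c * s) := by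
  rw [← exp_neg_mul_div_rpow hp]
  exact Real.rpow_le_rpow cutoffRoot_nonneg
    (max_le (sub_le_self _ (Real.exp_pos _).le) (Real.exp_pos _).le) hp.le

theorem exp_neg_mul_le_one (hc : 0 < c) (hs : 0 ≤ s) : Real.exp (-c * s) ≤ 1 :=
  Real.exp_le_one_iff.2 (by nlinarith)

theorem cutoff_le_one (hp : 0 < p) (hc : 0 < c) (hs : 0 ≤ s) : cutoff p c R s ≤ 1 :=
  (cutoff_le_exp hp).trans (exp_neg_mul_le_one hc hs)

theorem exp_le_weighted_cutoff_add {τ : ℝ} (hp : 1 ≤ p) (hτ : τ ∈ Ioo 0 1) :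
    Real.exp (-c * s) ≤
      (1 - τ) ^ (1 - p) * cutoff p c R s + τ ^ (1 - p) * Real.exp (-c * R) := by
  have hp0 : 0 < p := by linarith
  rw [← exp_neg_mul_div_rpow hp0 (s := s), ← exp_neg_mul_div_rpow hp0 (s := R)]
  refine le_trans (Real.rpow_le_rpow (Real.exp_pos _).le ?_ hp0.le)
    (add_rpow_le_weighted hp hτ cutoffRoot_nonneg (Real.exp_pos _).le)
  exact sub_le_iff_le_add.1 (le_max_left _ _)

theorem hasDerivAt_cutoff (hp : 1 < p) (c R s : ℝ) :
    HasDerivAt (cutoff p c R)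
      (-(c * Real.exp (-c * s / p) * cutoffRoot p c R s ^ (p - 1))) s := by
  have hexp : HasDerivAt (fun s => Real.exp (-c * s / p) - Real.exp (-c * R / p))
      (Real.exp (-c * s / p) * (-c / p)) s := by
    simpa using
      (((hasDerivAt_id s).const_mul (-c)).div_const p).exp.sub_const (Real.exp (-c * R / p))
  refine ((hasDerivAt_max_zero_rpow hp _).comp s hexp).congr_deriv ?_
  have : p ≠ 0 := by linarith
  rw [cutoffRoot]
  field_simp

theorem contDiff_cutoff (hp : 1 < p) (c R : ℝ) : ContDiff ℝ 1 (cutoff p c R) := by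
  rw [contDiff_one_iff_deriv]
  refine ⟨fun s => (hasDerivAt_cutoff hp c R s).differentiableAt, ?_⟩
  rw [show deriv (cutoff p c R) = _ from funext fun s => (hasDerivAt_cutoff hp c R s).deriv]
  unfold cutoffRoot
  exact ((by fun_prop : Continuous fun s => c * Real.exp (-c * s / p)).mul
    (Continuous.rpow_const (by fun_prop) fun s => Or.inr (by linarith))).neg

end Cutoff

section Truncation

variable {γ δ : ℝ}

/-- A smooth truncation of `t²` to the interval `[δ, 1/δ]`, tending to `t²` as `δ → 0`. -/
def truncSq (δ t : ℝ) : ℝ :=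
  (δ + t ^ 2) / (1 + δ * t ^ 2)

/-- A bounded smooth approximation of `|t|^γ`. -/
def truncWeight (γ δ t : ℝ) : ℝ :=
  truncSq δ t ^ (γ / 2)

/-- The ratio of the derivative of `t * truncWeight γ δ t` to `truncWeight γ δ t`; it approximates
the ratio `1 + γ` of the derivative of `t |t|^γ` to `|t|^γ`. -/
def truncRatio (γ δ t : ℝ) : ℝ :=
  1 + γ * (t ^ 2 * (1 - δ ^ 2) / ((δ + t ^ 2) * (1 + δ * t ^ 2)))

theorem truncSq_pos (hδ : 0 < δ) (t : ℝ) : 0 < truncSq δ t := by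
  unfold truncSq; positivity

theorem truncWeight_nonneg (hδ : 0 < δ) (t : ℝ) : 0 ≤ truncWeight γ δ t :=
  Real.rpow_nonneg (truncSq_pos hδ t).le _

theorem truncSq_mem_uIcc_inv (hδ : δ ∈ Ioc 0 1) (t : ℝ) : truncSq δ t ∈ uIcc δ δ⁻¹ := by
  obtain ⟨hδ0, hδ1⟩ := hδ
  have hδsq : δ ^ 2 ≤ 1 := pow_le_one₀ hδ0.le hδ1
  refine mem_uIcc_of_le ?_ ?_
  · rw [truncSq, le_div_iff₀ (by positivity)]
    nlinarith [mul_le_mul_of_nonneg_right hδsq (sq_nonneg t)]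
  · rw [truncSq, div_le_iff₀ (by positivity), mul_add, inv_mul_cancel_left₀ hδ0.ne', mul_one]
    gcongr
    exact hδ1.trans ((one_le_inv₀ hδ0).2 hδ1)

theorem truncSq_mem_uIcc_sq (hδ : δ ∈ Ioc 0 1) (t : ℝ) : truncSq δ t ∈ uIcc 1 (t ^ 2) := by
  obtain ⟨hδ0, hδ1⟩ := hδ
  have hden : 0 < 1 + δ * t ^ 2 := by positivity
  rcases le_total 1 (t ^ 2) with ht | ht
  · refine mem_uIcc_of_le ?_ ?_
    · rw [truncSq, one_le_div hden]; nlinarith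
    · rw [truncSq, div_le_iff₀ hden]
      nlinarith [mul_le_mul_of_nonneg_left (one_le_pow₀ ht (n := 2)) hδ0.le]
  · refine mem_uIcc_of_ge ?_ ?_
    · rw [truncSq, le_div_iff₀ hden]
      nlinarith [mul_le_mul_of_nonneg_left (pow_le_one₀ (sq_nonneg t) ht (n := 2)) hδ0.le]
    · rw [truncSq, div_le_one hden]; nlinarith

theorem truncWeight_le (hδ : δ ∈ Ioc 0 1) (t : ℝ) :
    truncWeight γ δ t ≤ δ ^ (γ / 2) + δ⁻¹ ^ (γ / 2) :=
  rpow_le_add_rpow_of_mem_uIcc _ hδ.1 (inv_pos.2 hδ.1) (truncSq_mem_uIcc_inv hδ t)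

theorem sq_rpow_half (t γ : ℝ) : (t ^ 2) ^ (γ / 2) = |t| ^ γ := by
  rw [← sq_abs, ← Real.rpow_natCast, ← Real.rpow_mul (abs_nonneg t)]
  congr 1
  push_cast
  ring

theorem abs_rpow_mul_truncWeight_le {p : ℝ} (hp : 0 < p) (hδ : δ ∈ Ioc 0 1) (t : ℝ) :
    |t| ^ p * truncWeight γ δ t ≤ |t| ^ p + |t| ^ (p + γ) := by
  rcases eq_or_ne t 0 with rfl | ht
  · rw [abs_zero, Real.zero_rpow hp.ne', zero_mul, zero_add]
    positivity
  have hweight : truncWeight γ δ t ≤ 1 + |t| ^ γ := by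
    simpa [truncWeight, sq_rpow_half] using
      rpow_le_add_rpow_of_mem_uIcc (γ / 2) one_pos (by positivity) (truncSq_mem_uIcc_sq hδ t)
  rw [Real.rpow_add (abs_pos.2 ht), ← mul_one_add]
  gcongr

theorem truncRatio_mem_uIcc (hδ : δ ∈ Ioc 0 1) (t : ℝ) :
    truncRatio γ δ t ∈ uIcc 1 (1 + γ) := by
  obtain ⟨hδ0, hδ1⟩ := hδ
  have hδsq : 0 ≤ 1 - δ ^ 2 := sub_nonneg.2 (pow_le_one₀ hδ0.le hδ1)
  set θ := t ^ 2 * (1 - δ ^ 2) / ((δ + t ^ 2) * (1 + δ * t ^ 2)) with hθ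
  have hθ0 : 0 ≤ θ := by positivity
  have hθ1 : θ ≤ 1 := by
    rw [hθ, div_le_one (by positivity)]
    nlinarith [mul_nonneg hδ0.le (sq_nonneg (t ^ 2)), mul_nonneg (sq_nonneg δ) (sq_nonneg t)]
  rw [truncRatio, ← hθ]
  rcases le_total 0 γ with hγ | hγ
  · exact mem_uIcc_of_le (by nlinarith) (by nlinarith)
  · exact mem_uIcc_of_ge (by nlinarith) (by nlinarith)

theorem truncRatio_pos (hγ : 0 < 1 + γ) (hδ : δ ∈ Ioc 0 1) (t : ℝ) : 0 < truncRatio γ δ t :=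
  (lt_min one_pos hγ).trans_le (truncRatio_mem_uIcc hδ t).1

theorem hasDerivAt_mul_truncWeight (hδ : 0 < δ) (t : ℝ) :
    HasDerivAt (fun t => t * truncWeight γ δ t) (truncRatio γ δ t * truncWeight γ δ t) t := by
  have hden : 0 < 1 + δ * t ^ 2 := by positivity
  have : 0 < δ + t ^ 2 := by positivity
  have hsq : HasDerivAt (truncSq δ) (2 * t * (1 - δ ^ 2) / (1 + δ * t ^ 2) ^ 2) t := by
    refine (((hasDerivAt_pow 2 t).const_add δ).div
      (((hasDerivAt_pow 2 t).const_mul δ).const_add 1) hden.ne').congr_deriv ?_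
    simp only [Nat.cast_ofNat, Nat.add_one_sub_one, pow_one]
    ring
  refine ((hasDerivAt_id t).mul
    (hsq.rpow_const (p := γ / 2) (Or.inl (truncSq_pos hδ t).ne'))).congr_deriv ?_
  rw [Real.rpow_sub_one (truncSq_pos hδ t).ne', id, truncRatio, truncWeight]
  generalize truncSq δ t ^ (γ / 2) = β
  rw [truncSq]
  field_simp

theorem continuous_truncSq (hδ : 0 < δ) : Continuous (truncSq δ) := by
  unfold truncSq
  exact Continuous.div (by fun_prop) (by fun_prop) fun t => by positivity

theorem continuous_truncWeight (hδ : 0 < δ) : Continuous (truncWeight γ δ) :=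
  (continuous_truncSq hδ).rpow_const fun t => Or.inl (truncSq_pos hδ t).ne'

theorem continuous_truncRatio (hδ : 0 < δ) : Continuous (truncRatio γ δ) := by
  unfold truncRatio
  exact continuous_const.add (continuous_const.mul
    (Continuous.div (by fun_prop) (by fun_prop) fun t => by positivity))

theorem contDiff_mul_truncWeight (hδ : 0 < δ) :
    ContDiff ℝ 1 fun t => t * truncWeight γ δ t := by
  rw [contDiff_one_iff_deriv]
  refine ⟨fun t => (hasDerivAt_mul_truncWeight hδ t).differentiableAt, ?_⟩
  rw [show deriv _ = _ from funext fun t => (hasDerivAt_mul_truncWeight hδ t).deriv]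
  exact (continuous_truncRatio hδ).mul (continuous_truncWeight hδ)

theorem exists_norm_deriv_mul_truncWeight_le (hγ : 0 < 1 + γ) (hδ : δ ∈ Ioc 0 1) :
    ∃ L : ℝ≥0, ∀ t, ‖deriv (fun t => t * truncWeight γ δ t) t‖ ≤ L := by
  refine ⟨⟨max 1 (1 + γ) * (δ ^ (γ / 2) + δ⁻¹ ^ (γ / 2)), ?_⟩, fun t => ?_⟩
  · have := hδ.1
    positivity
  · have hσ := (truncRatio_pos hγ hδ t).le
    have hβ := truncWeight_nonneg (γ := γ) hδ.1 t
    rw [(hasDerivAt_mul_truncWeight hδ.1 t).deriv, Real.norm_of_nonneg (by positivity)]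
    exact mul_le_mul (truncRatio_mem_uIcc hδ t).2 (truncWeight_le hδ t) hβ
      (hσ.trans (truncRatio_mem_uIcc hδ t).2)

theorem tendsto_truncWeight (γ : ℝ) {t : ℝ} (ht : t ≠ 0) :
    Tendsto (fun δ => truncWeight γ δ t) (𝓝 0) (𝓝 (|t| ^ γ)) := by
  have hsq : Tendsto (fun δ => truncSq δ t) (𝓝 0) (𝓝 (t ^ 2)) := by
    have hcont : ContinuousAt (fun δ => truncSq δ t) 0 := by
      unfold truncSq
      exact ContinuousAt.div (by fun_prop) (by fun_prop) (by simp)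
    simpa [ContinuousAt, truncSq] using hcont
  rw [← sq_rpow_half]
  exact hsq.rpow_const (Or.inl (pow_ne_zero 2 ht))

theorem tendsto_truncRatio (γ : ℝ) {t : ℝ} (ht : t ≠ 0) :
    Tendsto (fun δ => truncRatio γ δ t) (𝓝 0) (𝓝 (1 + γ)) := by
  have hcont : ContinuousAt (fun δ => truncRatio γ δ t) 0 := by
    unfold truncRatio
    exact continuousAt_const.add (continuousAt_const.mul
      (ContinuousAt.div (by fun_prop) (by fun_prop) (by simpa using ht)))
  simpa [ContinuousAt, truncRatio, ht] using hcont

end Truncation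

section Coercivity

/-- The factor `Θ` in front of `|u|^p e^{-cr}` which is left after the gradient terms of the
equation `L u = lam |u|^{p-2} u`, tested with `u` times a cut-off, are absorbed by Young's
inequality. -/
def absorptionConst (p lam k c : ℝ) : ℝ :=
  (p - 1) ^ (p - 1) * (k * c / p) ^ p / lam

theorem absorptionConst_nonneg {p lam k c : ℝ} (hp : 1 < p) (hlam : 0 < lam) (hk : 0 < k)
    (hc : 0 < c) : 0 ≤ absorptionConst p lam k c := by
  have : 0 < p - 1 := by linarith
  unfold absorptionConst
  positivity

theorem absorptionConst_mul_rpow_lt_one {p lam k c α : ℝ} (hp : 1 < p) (hlam : 0 < lam)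
    (hk : 0 < k) (hc : 0 < c) (hα : 0 < α)
    (h : c < p * α ^ (1 / Real.conjExponent p) / (p - 1) ^ (1 / Real.conjExponent p) *
      (lam ^ (1 / p) / k)) :
    absorptionConst p lam k c * α ^ (1 - p) < 1 := by
  have hp0 : 0 < p := by linarith
  have hp1 : 0 < p - 1 := by linarith
  rw [Real.conjExponent, one_div_div] at h
  have hbase : k * c / p < α ^ ((p - 1) / p) / (p - 1) ^ ((p - 1) / p) * lam ^ (1 / p) :=
    calc k * c / p < k * (p * α ^ ((p - 1) / p) / (p - 1) ^ ((p - 1) / p) *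
          (lam ^ (1 / p) / k)) / p := by gcongr
      _ = _ := by field_simp
  have hpow : (k * c / p) ^ p < α ^ (p - 1) / (p - 1) ^ (p - 1) * lam := by
    refine (Real.rpow_lt_rpow (by positivity) hbase hp0).trans_eq ?_
    rw [Real.mul_rpow (by positivity) (by positivity),
      Real.div_rpow (by positivity) (by positivity), ← Real.rpow_mul hα.le,
      ← Real.rpow_mul hp1.le, ← Real.rpow_mul hlam.le,
      div_mul_cancel₀ _ hp0.ne', div_mul_cancel₀ _ hp0.ne', Real.rpow_one]
  rw [absorptionConst, ← neg_sub p 1, Real.rpow_neg hα.le, ← div_eq_mul_inv,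
    div_lt_one (by positivity), div_lt_iff₀ hlam]
  calc (p - 1) ^ (p - 1) * (k * c / p) ^ p
      < (p - 1) ^ (p - 1) * (α ^ (p - 1) / (p - 1) ^ (p - 1) * lam) := by gcongr
    _ = α ^ (p - 1) * lam := by field_simp

variable {E : Type*} [NormedAddCommGroup E] [InnerProductSpace ℝ E] {p k : ℝ} {a ξ : E}

theorem norm_le_of_coercive (hp : 1 < p) (hk : 0 < k) (ha : 0 ≤ ⟪a, ξ⟫_ℝ)
    (hak : ‖a‖ ≤ k * ⟪a, ξ⟫_ℝ ^ ((p - 1) / p)) : ‖a‖ ≤ k ^ p * ‖ξ‖ ^ (p - 1) := by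
  have hp0 : 0 < p := by linarith
  have : 0 < p - 1 := by linarith
  rcases (norm_nonneg a).eq_or_lt with ha0 | ha0
  · rw [← ha0]
    positivity
  have hle : ‖a‖ ≤ k * (‖a‖ * ‖ξ‖) ^ ((p - 1) / p) := by
    refine hak.trans ?_
    gcongr
    exact real_inner_le_norm a ξ
  have hpow : ‖a‖ ^ (p - 1) * ‖a‖ ≤ ‖a‖ ^ (p - 1) * (k ^ p * ‖ξ‖ ^ (p - 1)) :=
    calc ‖a‖ ^ (p - 1) * ‖a‖ = ‖a‖ ^ p := by rw [← Real.rpow_add_one ha0.ne', sub_add_cancel]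
      _ ≤ (k * (‖a‖ * ‖ξ‖) ^ ((p - 1) / p)) ^ p := Real.rpow_le_rpow ha0.le hle hp0.le
      _ = ‖a‖ ^ (p - 1) * (k ^ p * ‖ξ‖ ^ (p - 1)) := by
        rw [Real.mul_rpow hk.le (by positivity), ← Real.rpow_mul (by positivity),
          div_mul_cancel₀ _ hp0.ne', Real.mul_rpow ha0.le (norm_nonneg ξ)]
        ring
  exact le_of_mul_le_mul_left hpow (by positivity)

theorem neg_le_inner_of_coercive {c σ w z s : ℝ} {ν : E} (hp : 1 < p) (hk : 0 < k) (hc : 0 < c)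
    (hσ : 0 < σ) (hw : 0 ≤ w) (hz : 0 ≤ z) (ha : 0 ≤ ⟪a, ξ⟫_ℝ)
    (hak : ‖a‖ ≤ k * ⟪a, ξ⟫_ℝ ^ ((p - 1) / p)) (hν : ‖ν‖ ≤ c * w * z ^ (p - 1)) :
    -((p - 1) ^ (p - 1) * (k * c / p) ^ p * σ ^ (1 - p) * |s| ^ p * w ^ p) ≤
      ⟪a, (σ * z ^ p) • ξ + s • ν⟫_ℝ := by
  have hp0 : 0 < p := by linarith
  set b := ⟪a, ξ⟫_ℝ
  have hyoung := rpow_sub_one_mul_le_add hp hσ (by positivity : 0 ≤ b ^ p⁻¹ * z)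
    (by positivity : 0 ≤ k * c * w * |s|)
  have hpow : ((b ^ p⁻¹ * z) ^ p) = b * z ^ p := by
    rw [Real.mul_rpow (by positivity) hz, Real.rpow_inv_rpow ha hp0.ne']
  have hpow' : (b ^ p⁻¹ * z) ^ (p - 1) = b ^ ((p - 1) / p) * z ^ (p - 1) := by
    rw [Real.mul_rpow (by positivity) hz, ← Real.rpow_mul ha, inv_mul_eq_div]
  have hconst : (p - 1) ^ (p - 1) / p ^ p * σ ^ (1 - p) * (k * c * w * |s|) ^ p =
      (p - 1) ^ (p - 1) * (k * c / p) ^ p * σ ^ (1 - p) * |s| ^ p * w ^ p := by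
    rw [Real.mul_rpow (by positivity) (abs_nonneg s), Real.mul_rpow (by positivity) hw,
      Real.div_rpow (by positivity) hp0.le]
    ring
  rw [hpow, hpow', hconst] at hyoung
  have hcross : |s * ⟪a, ν⟫_ℝ| ≤ b ^ ((p - 1) / p) * z ^ (p - 1) * (k * c * w * |s|) :=
    calc |s * ⟪a, ν⟫_ℝ| ≤ |s| * (‖a‖ * ‖ν‖) := by
          rw [abs_mul]
          gcongr
          exact abs_real_inner_le_norm a ν
      _ ≤ |s| * (k * b ^ ((p - 1) / p) * (c * w * z ^ (p - 1))) := by gcongr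
      _ = _ := by ring
  rw [inner_add_right, real_inner_smul_right, real_inner_smul_right]
  linarith [(abs_le.1 hcross).1]

end Coercivity

section Energy

variable {Ω : Type*} [MeasurableSpace Ω] {μ : Measure Ω} {f u r : Ω → ℝ} {p c R κ : ℝ}

theorem integrable_mul_cutoff (hp : 1 < p) (hc : 0 < c) (hr : Measurable r) (hr0 : ∀ x, 0 ≤ r x)
    (hf : Integrable f μ) : Integrable (fun x => f x * cutoff p c R (r x)) μ := by
  refine hf.mul_bdd (c := 1)
    ((contDiff_cutoff hp c R).continuous.measurable.comp hr).aestronglyMeasurable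
    (Eventually.of_forall fun x => ?_)
  rw [Real.norm_of_nonneg cutoff_nonneg]
  exact cutoff_le_one (by linarith) hc (hr0 x)

theorem integrable_mul_exp (hc : 0 < c) (hr : Measurable r) (hr0 : ∀ x, 0 ≤ r x)
    (hf : Integrable f μ) : Integrable (fun x => f x * Real.exp (-c * r x)) μ := by
  refine hf.mul_bdd (c := 1)
    (by fun_prop : Measurable fun x => Real.exp (-c * r x)).aestronglyMeasurable
    (Eventually.of_forall fun x => ?_)
  rw [Real.norm_of_nonneg (Real.exp_pos _).le]
  exact exp_neg_mul_le_one hc (hr0 x)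

theorem mul_integral_cutoff_le {τ : ℝ} (hp : 1 < p) (hc : 0 < c) (hκ : 0 ≤ κ) (hτ : τ ∈ Ioo 0 1)
    (hf0 : ∀ x, 0 ≤ f x) (hr : Measurable r) (hr0 : ∀ x, 0 ≤ r x) (hf : Integrable f μ)
    (henergy : ∫ x, f x * (cutoff p c R (r x) - κ * Real.exp (-c * r x)) ∂μ ≤ 0) :
    (1 - κ * (1 - τ) ^ (1 - p)) * ∫ x, f x * cutoff p c R (r x) ∂μ ≤
      κ * τ ^ (1 - p) * Real.exp (-c * R) * ∫ x, f x ∂μ := by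
  have hcut := integrable_mul_cutoff (R := R) hp hc hr hr0 hf
  have hexp := integrable_mul_exp hc hr hr0 hf
  rw [← sub_nonpos, ← integral_const_mul, ← integral_const_mul,
    ← integral_sub (hcut.const_mul _) (hf.const_mul _)]
  refine le_trans (integral_mono ((hcut.const_mul _).sub (hf.const_mul _))
    ((hcut.sub (hexp.const_mul κ)).congr (Eventually.of_forall fun x => ?_)) fun x => ?_) henergy
  · simp only [Pi.sub_apply]
    ring
  · have hweighted := mul_le_mul_of_nonneg_left
      (exp_le_weighted_cutoff_add (c := c) (R := R) (s := r x) hp.le hτ) (mul_nonneg hκ (hf0 x))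
    simp only
    linarith

theorem setIntegral_cutoff_nonpos {C : ℝ} (hp : 1 < p) (hc : 0 < c) (hC : C < c) (hκ0 : 0 ≤ κ)
    (hκ1 : κ < 1) (hf0 : ∀ x, 0 ≤ f x) (hr : Measurable r) (hr0 : ∀ x, 0 ≤ r x)
    (hf : ∀ R, IntegrableOn f {x | r x < R} μ)
    (hgrowth : ∀ᶠ R in atTop, ∫ x in {x | r x < R}, f x ∂μ ≤ Real.exp (C * R))
    (henergy : ∀ R, ∫ x in {x | r x < R},
      f x * (cutoff p c R (r x) - κ * Real.exp (-c * r x)) ∂μ ≤ 0) (R : ℝ) :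
    ∫ x in {x | r x < R}, f x * cutoff p c R (r x) ∂μ ≤ 0 := by
  have hp0 : 0 < p := by linarith
  obtain ⟨τ, hτ, hθ⟩ := exists_mul_one_sub_rpow_lt_one p hκ1
  set E : ℝ → ℝ := fun R => ∫ x in {x | r x < R}, f x * cutoff p c R (r x) ∂μ
  have hmono : ∀ R', R ≤ R' → E R ≤ E R' := fun R' hR => by
    have hsub : {x | r x < R} ⊆ {x | r x < R'} := fun x (hx : r x < R) => hx.trans_le hR
    have hinteg := integrable_mul_cutoff (R := R') hp hc hr hr0 (hf R')
    refine le_trans (integral_mono (integrable_mul_cutoff hp hc hr hr0 (hf R))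
      (hinteg.mono_measure (Measure.restrict_mono_set μ hsub)) fun x => ?_)
      (setIntegral_mono_set hinteg (Eventually.of_forall fun x => ?_) hsub.eventuallyLE)
    · exact mul_le_mul_of_nonneg_left (cutoff_mono hp0 hc hR) (hf0 x)
    · exact mul_nonneg (hf0 x) cutoff_nonneg
  have hbound : ∀ᶠ R' in atTop, (1 - κ * (1 - τ) ^ (1 - p)) * E R ≤
      κ * τ ^ (1 - p) * Real.exp ((C - c) * R') := by
    filter_upwards [hgrowth, eventually_ge_atTop R] with R' hR' hRR'
    have hτ0 : 0 < τ := hτ.1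
    calc (1 - κ * (1 - τ) ^ (1 - p)) * E R ≤ (1 - κ * (1 - τ) ^ (1 - p)) * E R' :=
          mul_le_mul_of_nonneg_left (hmono R' hRR') (sub_nonneg.2 hθ.le)
      _ ≤ κ * τ ^ (1 - p) * Real.exp (-c * R') * ∫ x in {x | r x < R'}, f x ∂μ :=
          mul_integral_cutoff_le hp hc hκ0 hτ hf0 hr hr0 (hf R') (henergy R')
      _ ≤ κ * τ ^ (1 - p) * Real.exp (-c * R') * Real.exp (C * R') := by gcongr
      _ = κ * τ ^ (1 - p) * Real.exp ((C - c) * R') := by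
          rw [mul_assoc, ← Real.exp_add]
          ring_nf
  have hlim : Tendsto (fun R' => κ * τ ^ (1 - p) * Real.exp ((C - c) * R')) atTop (𝓝 0) := by
    simpa using (Real.tendsto_exp_atBot.comp
      (tendsto_id.const_mul_atTop_of_neg (sub_neg.2 hC))).const_mul (κ * τ ^ (1 - p))
  exact nonpos_of_mul_nonpos_right (ge_of_tendsto hlim hbound) (sub_pos.2 hθ)

theorem ae_eq_zero_of_energy {C : ℝ} (hp : 1 < p) (hc : 0 < c) (hC : C < c) (hκ0 : 0 ≤ κ)
    (hκ1 : κ < 1) (hf0 : ∀ x, 0 ≤ f x) (hr : Measurable r) (hr0 : ∀ x, 0 ≤ r x)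
    (hf : ∀ R, IntegrableOn f {x | r x < R} μ)
    (hgrowth : ∀ᶠ R in atTop, ∫ x in {x | r x < R}, f x ∂μ ≤ Real.exp (C * R))
    (henergy : ∀ R, ∫ x in {x | r x < R},
      f x * (cutoff p c R (r x) - κ * Real.exp (-c * r x)) ∂μ ≤ 0) :
    f =ᵐ[μ] 0 := by
  have hball : ∀ R : ℝ, ∀ᵐ x ∂μ, r x < R → f x = 0 := fun R => by
    have hnonneg : ∀ x, 0 ≤ f x * cutoff p c R (r x) := fun x => mul_nonneg (hf0 x) cutoff_nonneg
    have hzero := (integral_eq_zero_iff_of_nonneg hnonneg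
      (integrable_mul_cutoff hp hc hr hr0 (hf R))).1 (le_antisymm
        (setIntegral_cutoff_nonpos hp hc hC hκ0 hκ1 hf0 hr hr0 hf hgrowth henergy R)
        (integral_nonneg hnonneg))
    filter_upwards [(ae_restrict_iff' (measurableSet_lt hr measurable_const)).1 hzero]
      with x hx hxR
    exact (mul_eq_zero.1 (hx hxR)).resolve_right (cutoff_pos (by linarith) hc hxR).ne'
  filter_upwards [ae_all_iff.2 fun n : ℕ => hball n] with x hx
  obtain ⟨n, hn⟩ := exists_nat_gt (r x)
  exact hx n hn

end Energy

section TruncatedEnergy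

variable {p c R Θ γ δ : ℝ}

/-- The density of the energy inequality for the truncation of `|u|^{p + γ}` by
`|u|^p * truncWeight γ δ u`, at a point at distance `s` from the centre where `u` equals `t`. -/
def truncEnergy (p c R Θ γ δ t s : ℝ) : ℝ :=
  |t| ^ p * truncWeight γ δ t *
    (cutoff p c R s - Θ * truncRatio γ δ t ^ (1 - p) * Real.exp (-c * s))

theorem norm_truncEnergy_le {t s : ℝ} (hp : 1 < p) (hc : 0 < c) (hΘ : 0 ≤ Θ) (hγ : 0 < 1 + γ)
    (hδ : δ ∈ Ioc 0 1) (hs : 0 ≤ s) :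
    ‖truncEnergy p c R Θ γ δ t s‖ ≤
      (|t| ^ p + |t| ^ (p + γ)) * (1 + Θ * (1 + (1 + γ) ^ (1 - p))) := by
  have hp0 : 0 < p := by linarith
  have hσ := truncRatio_pos hγ hδ t
  have hσ' : truncRatio γ δ t ^ (1 - p) ≤ 1 + (1 + γ) ^ (1 - p) := by
    simpa using rpow_le_add_rpow_of_mem_uIcc (1 - p) one_pos hγ (truncRatio_mem_uIcc hδ t)
  have hβ := truncWeight_nonneg (γ := γ) hδ.1 t
  have hexp : Θ * truncRatio γ δ t ^ (1 - p) * Real.exp (-c * s) ≤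
      Θ * (1 + (1 + γ) ^ (1 - p)) * 1 := by
    gcongr
    exact exp_neg_mul_le_one hc hs
  have hexp0 : 0 ≤ Θ * truncRatio γ δ t ^ (1 - p) * Real.exp (-c * s) := by positivity
  rw [truncEnergy, norm_mul, Real.norm_of_nonneg (by positivity : 0 ≤ |t| ^ p * truncWeight γ δ t)]
  refine mul_le_mul (abs_rpow_mul_truncWeight_le hp0 hδ t) ?_ (norm_nonneg _) (by positivity)
  rw [Real.norm_eq_abs, abs_le]
  have hcut0 := cutoff_nonneg (p := p) (c := c) (R := R) (s := s)
  have hcut1 := cutoff_le_one (R := R) hp0 hc hs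
  constructor <;> linarith

theorem tendsto_truncEnergy (hp : 0 < p) (hγ : 0 < 1 + γ) (hpγ : p + γ ≠ 0) (t s : ℝ) :
    Tendsto (fun δ => truncEnergy p c R Θ γ δ t s) (𝓝 0)
      (𝓝 (|t| ^ (p + γ) *
        (cutoff p c R s - Θ * (1 + γ) ^ (1 - p) * Real.exp (-c * s)))) := by
  rcases eq_or_ne t 0 with rfl | ht
  · simp [truncEnergy, Real.zero_rpow hp.ne', Real.zero_rpow hpγ]
  · rw [Real.rpow_add (abs_pos.2 ht)]
    exact ((tendsto_truncWeight γ ht).const_mul _).mul (tendsto_const_nhds.sub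
      ((((tendsto_truncRatio γ ht).rpow_const (Or.inl hγ.ne')).const_mul Θ).mul_const _))

variable {Ω : Type*} [MeasurableSpace Ω] {μ : Measure Ω} {u r : Ω → ℝ}

theorem aestronglyMeasurable_truncEnergy (hp : 1 < p) (hγ : 0 < 1 + γ) (hδ : δ ∈ Ioc 0 1)
    (hu : AEMeasurable u μ) (hr : Measurable r) :
    AEStronglyMeasurable (fun x => truncEnergy p c R Θ γ δ (u x) (r x)) μ := by
  have hcont : Continuous fun z : ℝ × ℝ => truncEnergy p c R Θ γ δ z.1 z.2 := by
    have hcut := (contDiff_cutoff hp c R).continuous.comp (continuous_snd (X := ℝ))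
    have hβ := (continuous_truncWeight (γ := γ) hδ.1).comp (continuous_fst (Y := ℝ))
    have hσ := ((continuous_truncRatio (γ := γ) hδ.1).comp (continuous_fst (Y := ℝ))).rpow_const
      (p := 1 - p) fun z => Or.inl (truncRatio_pos hγ hδ z.1).ne'
    have habs := (continuous_fst (X := ℝ) (Y := ℝ)).abs.rpow_const (p := p)
      fun _ => Or.inr (by linarith)
    exact (habs.mul hβ).mul (hcut.sub ((continuous_const.mul hσ).mul (by fun_prop)))
  exact (hcont.measurable.comp_aemeasurable (hu.prodMk hr.aemeasurable)).aestronglyMeasurable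

theorem integrable_truncEnergy (hp : 1 < p) (hc : 0 < c) (hΘ : 0 ≤ Θ) (hγ : 0 < 1 + γ)
    (hδ : δ ∈ Ioc 0 1) (hu : AEMeasurable u μ) (hr : Measurable r) (hr0 : ∀ x, 0 ≤ r x)
    (hinteg : Integrable (fun x => |u x| ^ p + |u x| ^ (p + γ)) μ) :
    Integrable (fun x => truncEnergy p c R Θ γ δ (u x) (r x)) μ :=
  (hinteg.mul_const _).mono' (aestronglyMeasurable_truncEnergy hp hγ hδ hu hr)
    (Eventually.of_forall fun x => norm_truncEnergy_le hp hc hΘ hγ hδ (hr0 x))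

theorem integrable_truncWeight_mul_cutoff (hp : 1 < p) (hc : 0 < c) (hδ : δ ∈ Ioc 0 1)
    (hu : AEMeasurable u μ) (hr : Measurable r) (hr0 : ∀ x, 0 ≤ r x)
    (hinteg : Integrable (fun x => |u x| ^ p + |u x| ^ (p + γ)) μ) :
    Integrable (fun x => |u x| ^ p * truncWeight γ δ (u x) * cutoff p c R (r x)) μ := by
  have hp0 : 0 < p := by linarith
  have hβ := (continuous_truncWeight (γ := γ) hδ.1).measurable.comp_aemeasurable hu
  refine integrable_mul_cutoff hp hc hr hr0 (hinteg.mono'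
    ((hu.abs.pow_const p).mul hβ).aestronglyMeasurable (Eventually.of_forall fun x => ?_))
  rw [Real.norm_of_nonneg (mul_nonneg (by positivity) (truncWeight_nonneg hδ.1 _))]
  exact abs_rpow_mul_truncWeight_le hp0 hδ _

theorem integral_energy_nonpos_of_truncEnergy (hp : 1 < p) (hc : 0 < c) (hΘ : 0 ≤ Θ)
    (hγ : 0 < 1 + γ) (hu : AEMeasurable u μ) (hr : Measurable r) (hr0 : ∀ x, 0 ≤ r x)
    (hinteg : Integrable (fun x => |u x| ^ p + |u x| ^ (p + γ)) μ)
    (htrunc : ∀ δ ∈ Ioc (0 : ℝ) 1, ∫ x, truncEnergy p c R Θ γ δ (u x) (r x) ∂μ ≤ 0) :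
    ∫ x, |u x| ^ (p + γ) *
      (cutoff p c R (r x) - Θ * (1 + γ) ^ (1 - p) * Real.exp (-c * r x)) ∂μ ≤ 0 := by
  have hδ : ∀ᶠ δ : ℝ in 𝓝[>] 0, δ ∈ Ioc 0 1 := Ioc_mem_nhdsGT one_pos
  refine le_of_tendsto (tendsto_integral_filter_of_dominated_convergence _
    (hδ.mono fun δ hδ => aestronglyMeasurable_truncEnergy hp hγ hδ hu hr)
    (hδ.mono fun δ hδ => Eventually.of_forall fun x =>
      norm_truncEnergy_le hp hc hΘ hγ hδ (hr0 x))
    (hinteg.mul_const _) (Eventually.of_forall fun x => ?_)) (hδ.mono htrunc)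
  exact (tendsto_truncEnergy (by linarith) hγ (by linarith) (u x) (r x)).mono_left
    nhdsWithin_le_nhds

end TruncatedEnergy

section SobolevProduct

variable {m : ℕ} {M : Type*} [MetricSpace M]
  [ChartedSpace (EuclideanSpace ℝ (Fin m)) M] [IsManifold (𝓡 m) ∞ M]
  [RiemannianBundle (fun x : M => TangentSpace (𝓡 m) x)]
  [IsContMDiffRiemannianBundle (𝓡 m) ∞ (EuclideanSpace ℝ (Fin m))
    (fun x : M => TangentSpace (𝓡 m) x)]
  [IsRiemannianManifold (𝓡 m) M]

theorem exists_norm_grad_le_on_compact {η : M → ℝ} (hη : LocallyLipschitz η) {K : Set M}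
    (hK : IsCompact K) : ∃ B, ∀ x ∈ K, ‖grad m η x‖ ≤ B := by
  refine hK.induction_on (p := fun S => ∃ B, ∀ x ∈ S, ‖grad m η x‖ ≤ B) ⟨0, by simp⟩
    (fun S T hST ⟨B, hB⟩ => ⟨B, fun x hx => hB x (hST hx)⟩) ?_ fun x _ => ?_
  · rintro S T ⟨B, hB⟩ ⟨B', hB'⟩
    exact ⟨max B B', fun x hx => hx.elim (fun h => (hB x h).trans (le_max_left _ _))
      fun h => (hB' x h).trans (le_max_right _ _)⟩
  · obtain ⟨L, U, hU, hL⟩ := hη x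
    refine ⟨interior U, mem_nhdsWithin_of_mem_nhds (interior_mem_nhds.2 hU), L, fun y hy => ?_⟩
    refine norm_grad_le ?_
    filter_upwards [mem_interior_iff_mem_nhds.1 hy] with z hz
    exact hL.dist_le_mul z hz y (interior_subset hy)

theorem HasSobolevGradient.comp_mul [SecondCountableTopology M] [MeasurableSpace M] [BorelSpace M]
    {p : ℝ} {u η : M → ℝ} {X : (x : M) → TangentSpace (𝓡 m) x} {h : ℝ → ℝ} {L : ℝ≥0}
    (hu : HasSobolevGradient p u X) (hh : ContDiff ℝ 1 h) (h0 : h 0 = 0)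
    (hL : ∀ t, ‖deriv h t‖ ≤ L) (hη : LocallyLipschitz η) :
    HasSobolevGradient p (fun x => h (u x) * η x)
      (fun x => (deriv h (u x) * η x) • X x + h (u x) • grad m η x) := by
  have hhu : ∀ t, ‖h t‖ ≤ L * ‖t‖ := fun t => by
    simpa [h0] using (lipschitzWith_of_nnnorm_deriv_le
      (hh.differentiable one_ne_zero) hL).norm_sub_le t 0
  have hgrad := hu.isWeakGradient.comp_mul hh hL hη
  refine ⟨hgrad, fun K hK => ?_, fun K hK => ?_⟩ <;>
    obtain ⟨B, hB⟩ := hK.exists_bound_of_continuousOn hη.continuous.continuousOn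
  · have hmem := hu.memLp K hK
    refine hmem.of_le_mul (c := L * B) ((hh.continuous.comp_aestronglyMeasurable
      hmem.aestronglyMeasurable).mul hη.continuous.aestronglyMeasurable) ?_
    filter_upwards [ae_restrict_mem hK.measurableSet] with x hx
    calc ‖h (u x) * η x‖ ≤ (L * ‖u x‖) * B := by
          rw [norm_mul]
          gcongr
          exacts [hhu _, hB x hx]
      _ = L * B * ‖u x‖ := by ring
  · obtain ⟨B', hB'⟩ := exists_norm_grad_le_on_compact (m := m) hη hK
    refine (((hu.memLp_grad K hK).const_mul (L * B)).add
      ((hu.memLp K hK).norm.const_mul (L * B'))).mono'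
      hgrad.isChartMeasurable.aemeasurable_norm.aestronglyMeasurable.restrict ?_
    filter_upwards [ae_restrict_mem hK.measurableSet] with x hx
    rw [norm_norm]
    calc ‖(deriv h (u x) * η x) • X x + h (u x) • grad m η x‖
        ≤ ‖deriv h (u x)‖ * ‖η x‖ * ‖X x‖ + ‖h (u x)‖ * ‖grad m η x‖ :=
          (norm_add_le _ _).trans_eq (by rw [norm_smul, norm_smul, norm_mul])
      _ ≤ L * B * ‖X x‖ + L * ‖u x‖ * B' := by
          gcongr
          exacts [hL _, hB x hx, hhu _, hB' x hx]
      _ = L * B * ‖X x‖ + L * B' * ‖u x‖ := by ring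

end SobolevProduct

section TestField

variable {m : ℕ} {M : Type*} [MetricSpace M]
  [ChartedSpace (EuclideanSpace ℝ (Fin m)) M] [IsManifold (𝓡 m) ∞ M]
  [RiemannianBundle (fun x : M => TangentSpace (𝓡 m) x)]
  [IsContMDiffRiemannianBundle (𝓡 m) ∞ (EuclideanSpace ℝ (Fin m))
    (fun x : M => TangentSpace (𝓡 m) x)]
  [IsRiemannianManifold (𝓡 m) M]
  {p lam k c R γ δ : ℝ} {u : M → ℝ} {X : (x : M) → TangentSpace (𝓡 m) x}

theorem norm_grad_cutoff_dist_le (hp : 1 < p) (hc : 0 < c) (x₀ x : M) :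
    ‖grad m (fun z => cutoff p c R (dist z x₀)) x‖ ≤
      c * Real.exp (-c * dist x x₀ / p) * cutoffRoot p c R (dist x x₀) ^ (p - 1) := by
  have hroot : 0 ≤ cutoffRoot p c R (dist x x₀) ^ (p - 1) := Real.rpow_nonneg cutoffRoot_nonneg _
  refine (norm_grad_comp_le (LipschitzWith.dist_left x₀) (hasDerivAt_cutoff hp c R _)).trans_eq ?_
  rw [abs_neg, abs_of_nonneg (by positivity), NNReal.coe_one, mul_one]

/-- The weak gradient of `u * truncWeight γ δ u` times the cut-off of radius `R` about `x₀`, when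
`X` is the weak gradient of `u`. -/
def testGradient (p c R γ δ : ℝ) (x₀ : M) (u : M → ℝ) (X : (x : M) → TangentSpace (𝓡 m) x)
    (x : M) : TangentSpace (𝓡 m) x :=
  truncWeight γ δ (u x) • ((truncRatio γ δ (u x) * cutoffRoot p c R (dist x x₀) ^ p) • X x +
    u x • grad m (fun z => cutoff p c R (dist z x₀)) x)

theorem testGradient_eq_zero (hp : 1 < p) (hc : 0 < c) {x₀ x : M} (hx : R ≤ dist x x₀) :
    testGradient p c R γ δ x₀ u X x = 0 := by
  have hgrad : grad m (fun z => cutoff p c R (dist z x₀)) x = 0 := by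
    have hle := norm_grad_cutoff_dist_le (m := m) (R := R) hp hc x₀ x
    rw [cutoffRoot_eq_zero (by linarith) hc hx, Real.zero_rpow (by linarith), mul_zero] at hle
    exact norm_le_zero_iff.1 hle
  rw [testGradient, hgrad, cutoffRoot_eq_zero (by linarith) hc hx, Real.zero_rpow (by linarith)]
  simp

theorem mul_truncEnergy_le (hp : 1 < p) (hlam : 0 < lam) (hk : 0 < k) (hc : 0 < c)
    (hγ : 0 < 1 + γ) (hδ : δ ∈ Ioc 0 1) (x₀ x : M) {V : TangentSpace (𝓡 m) x}
    (hV0 : 0 ≤ ⟪V, X x⟫_ℝ) (hV : ‖V‖ ≤ k * ⟪V, X x⟫_ℝ ^ ((p - 1) / p)) :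
    lam * truncEnergy p c R (absorptionConst p lam k c) γ δ (u x) (dist x x₀) ≤
      ⟪V, testGradient p c R γ δ x₀ u X x⟫_ℝ +
        lam * (|u x| ^ (p - 2) * u x) *
          (u x * truncWeight γ δ (u x) * cutoff p c R (dist x x₀)) := by
  have hp0 : 0 < p := by linarith
  have hcoercive := neg_le_inner_of_coercive (s := u x) hp hk hc
    (truncRatio_pos hγ hδ (u x)) (Real.exp_pos _).le cutoffRoot_nonneg hV0 hV
    (norm_grad_cutoff_dist_le (R := R) hp hc x₀ x)
  rw [exp_neg_mul_div_rpow hp0] at hcoercive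
  rw [testGradient, real_inner_smul_right]
  calc lam * truncEnergy p c R (absorptionConst p lam k c) γ δ (u x) (dist x x₀)
      = truncWeight γ δ (u x) * -((p - 1) ^ (p - 1) * (k * c / p) ^ p *
          truncRatio γ δ (u x) ^ (1 - p) * |u x| ^ p * Real.exp (-c * dist x x₀)) +
        lam * |u x| ^ p * (truncWeight γ δ (u x) * cutoff p c R (dist x x₀)) := by
        rw [truncEnergy, absorptionConst]
        field_simp
        ring
    _ ≤ _ := by
        rw [← abs_rpow_sub_two_mul_mul_self hp0 (u x)] at hcoercive ⊢
        refine add_le_add (mul_le_mul_of_nonneg_left hcoercive (truncWeight_nonneg hδ.1 _))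
          (le_of_eq ?_)
        ring

end TestField

section WeakSolution

variable {m : ℕ} {M : Type*} [MetricSpace M] [MeasurableSpace M]
  [ChartedSpace (EuclideanSpace ℝ (Fin m)) M]
  [RiemannianBundle (fun x : M => TangentSpace (𝓡 m) x)]
  {p k : ℝ} {A : (x : M) → ℝ → TangentSpace (𝓡 m) x → TangentSpace (𝓡 m) x}
  {u φ : M → ℝ} {X Y : (x : M) → TangentSpace (𝓡 m) x} {K : Set M}

theorem HasSobolevGradient.integrableOn_norm_rpow (hp : 0 < p) (hu : HasSobolevGradient p u X)
    (hK : IsCompact K) : IntegrableOn (fun x => |u x| ^ p) K (riemannianVolume m M) := by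
  have hinteg := (hu.memLp K hK).integrable_norm_rpow (by simpa using hp) ENNReal.ofReal_ne_top
  rwa [ENNReal.toReal_ofReal hp.le] at hinteg

theorem HasSobolevGradient.integrableOn_norm_grad_rpow (hp : 0 < p)
    (hu : HasSobolevGradient p u X) (hK : IsCompact K) :
    IntegrableOn (fun x => ‖X x‖ ^ p) K (riemannianVolume m M) := by
  have hinteg := (hu.memLp_grad K hK).integrable_norm_rpow (by simpa using hp)
    ENNReal.ofReal_ne_top
  simpa only [IntegrableOn, norm_norm, ENNReal.toReal_ofReal hp.le] using hinteg

variable [SecondCountableTopology M] [BorelSpace M] [IsManifold (𝓡 m) ∞ M]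
  [IsContMDiffRiemannianBundle (𝓡 m) ∞ (EuclideanSpace ℝ (Fin m))
    (fun x : M => TangentSpace (𝓡 m) x)]

theorem IsWeaklyCoercive.integrable_inner (hp : 1 < p) (hk : 0 < k) (hA : IsWeaklyCoercive p k A)
    (hu : HasSobolevGradient p u X) (hφ : HasSobolevGradient p φ Y) (hK : IsCompact K)
    (hY : ∀ x ∉ K, Y x = 0) :
    Integrable (fun x => ⟪A x (u x) (X x), Y x⟫_ℝ) (riemannianVolume m M) := by
  have hp0 : 0 < p := by linarith
  have hmeas : AEMeasurable (fun x => ⟪A x (u x) (X x), Y x⟫_ℝ) (riemannianVolume m M) :=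
    (hA.caratheodory.isChartMeasurable (fun _ he => hu.isWeakGradient.aemeasurable_comp_symm he)
      hu.isWeakGradient.isChartMeasurable).aemeasurable_inner hφ.isWeakGradient.isChartMeasurable
  have hsupp : Function.support (fun x => ⟪A x (u x) (X x), Y x⟫_ℝ) ⊆ K := fun x hx =>
    not_not.1 fun hxK => hx (by simp only [hY x hxK, inner_zero_right])
  rw [← integrableOn_iff_integrable_of_support_subset hsupp]
  refine (((hu.integrableOn_norm_grad_rpow hp0 hK).add
    ((hφ.integrableOn_norm_grad_rpow hp0 hK).const_mul ((p - 1) ^ (p - 1) / p ^ p))).const_mul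
    (k ^ p)).mono' hmeas.aestronglyMeasurable.restrict (Eventually.of_forall fun x => ?_)
  calc ‖⟪A x (u x) (X x), Y x⟫_ℝ‖ ≤ ‖A x (u x) (X x)‖ * ‖Y x‖ := norm_inner_le_norm _ _
    _ ≤ k ^ p * ‖X x‖ ^ (p - 1) * ‖Y x‖ := by
      gcongr
      exact norm_le_of_coercive hp hk (hA.inner_nonneg _ _ _) (hA.norm_le _ _ _)
    _ = k ^ p * (‖X x‖ ^ (p - 1) * ‖Y x‖) := by ring
    _ ≤ k ^ p * (‖X x‖ ^ p + (p - 1) ^ (p - 1) / p ^ p * ‖Y x‖ ^ p) := by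
      gcongr
      simpa using rpow_sub_one_mul_le_add hp one_pos (norm_nonneg (X x)) (norm_nonneg (Y x))

variable [IsRiemannianManifold (𝓡 m) M] {lam c R γ δ : ℝ}

theorem hasSobolevGradient_testGradient (hp : 1 < p) (hγ : 0 < 1 + γ) (hδ : δ ∈ Ioc 0 1) (x₀ : M)
    (hu : HasSobolevGradient p u X) :
    HasSobolevGradient p
      (fun x => u x * truncWeight γ δ (u x) * cutoff p c R (dist x x₀))
      (testGradient p c R γ δ x₀ u X) := by
  obtain ⟨L, hL⟩ := exists_norm_deriv_mul_truncWeight_le hγ hδ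
  have hη : LocallyLipschitz fun x => cutoff p c R (dist x x₀) :=
    (contDiff_cutoff hp c R).locallyLipschitz.comp (LipschitzWith.dist_left x₀).locallyLipschitz
  convert hu.comp_mul (contDiff_mul_truncWeight hδ.1) (zero_mul _) hL hη using 2 with x
  rw [(hasDerivAt_mul_truncWeight hδ.1 (u x)).deriv, testGradient, cutoff, smul_add, smul_smul,
    smul_smul]
  ring_nf

theorem integral_truncEnergy_nonpos [ProperSpace M] (hp : 1 < p) (hlam : 0 < lam) (hk : 0 < k)
    (hc : 0 < c) (hγ : 0 < 1 + γ) (hδ : δ ∈ Ioc 0 1) (hA : IsWeaklyCoercive p k A)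
    (hu : HasSobolevGradient p u X)
    (hsol : ∀ (φ : M → ℝ) (Y : (x : M) → TangentSpace (𝓡 m) x),
      HasSobolevGradient p φ Y → HasCompactSupport φ →
        -∫ x, ⟪A x (u x) (X x), Y x⟫_ℝ ∂(riemannianVolume m M) =
          ∫ x, lam * (|u x| ^ (p - 2) * u x) * φ x ∂(riemannianVolume m M))
    (x₀ : M) (hinteg : IntegrableOn (fun x => |u x| ^ p + |u x| ^ (p + γ)) (Metric.ball x₀ R)
      (riemannianVolume m M)) :
    ∫ x in Metric.ball x₀ R, truncEnergy p c R (absorptionConst p lam k c) γ δ (u x) (dist x x₀)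
      ∂(riemannianVolume m M) ≤ 0 := by
  have hp0 : 0 < p := by linarith
  have hmeas := hu.isWeakGradient.aemeasurable.restrict (s := Metric.ball x₀ R)
  have hdist : Measurable fun x => dist x x₀ := measurable_id.dist measurable_const
  have hcut : ∀ x ∉ Metric.ball x₀ R, cutoff p c R (dist x x₀) = 0 := fun x hx =>
    cutoff_eq_zero hp0 hc (not_lt.1 hx)
  have hY : ∀ x ∉ Metric.ball x₀ R, testGradient p c R γ δ x₀ u X x = 0 := fun x hx =>
    testGradient_eq_zero hp hc (not_lt.1 hx)
  have hK : IsCompact (Metric.closedBall x₀ R) := isCompact_closedBall x₀ R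
  have hballK : ∀ x ∉ Metric.closedBall x₀ R, x ∉ Metric.ball x₀ R := fun x hx hx' =>
    hx (Metric.ball_subset_closedBall hx')
  have hφ := hasSobolevGradient_testGradient (c := c) (R := R) hp hγ hδ x₀ hu
  have hweak := hsol _ _ hφ (HasCompactSupport.intro hK fun x hx => by
    rw [hcut x (hballK x hx), mul_zero])
  have hflux := (hA.integrable_inner hp hk hu hφ hK fun x hx => hY x (hballK x hx)).integrableOn
    (s := Metric.ball x₀ R)
  have hsource : IntegrableOn (fun x => lam * (|u x| ^ (p - 2) * u x) *
      (u x * truncWeight γ δ (u x) * cutoff p c R (dist x x₀))) (Metric.ball x₀ R)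
      (riemannianVolume m M) := by
    refine ((integrable_truncWeight_mul_cutoff (c := c) (R := R) hp hc hδ hmeas hdist
      (fun _ => dist_nonneg) hinteg).const_mul lam).congr (Eventually.of_forall fun x => ?_)
    simp only [← abs_rpow_sub_two_mul_mul_self hp0 (u x)]
    ring
  have hzero : ∫ x in Metric.ball x₀ R, (⟪A x (u x) (X x), testGradient p c R γ δ x₀ u X x⟫_ℝ +
      lam * (|u x| ^ (p - 2) * u x) * (u x * truncWeight γ δ (u x) * cutoff p c R (dist x x₀)))
      ∂(riemannianVolume m M) = 0 := by
    rw [integral_add hflux hsource, setIntegral_eq_integral_of_forall_compl_eq_zero fun x hx => by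
        rw [hY x hx, inner_zero_right],
      setIntegral_eq_integral_of_forall_compl_eq_zero fun x hx => by
        rw [hcut x hx, mul_zero, mul_zero], ← hweak, add_neg_cancel]
  have henergy := integral_mono ((integrable_truncEnergy hp hc
    (absorptionConst_nonneg hp hlam hk hc) hγ hδ hmeas hdist (fun _ => dist_nonneg)
    hinteg).const_mul lam) (hflux.add hsource) fun x => mul_truncEnergy_le hp hlam hk hc hγ hδ x₀ x
      (hA.inner_nonneg _ _ _) (hA.norm_le _ _ _)
  rw [integral_const_mul] at henergy
  exact nonpos_of_mul_nonpos_right (henergy.trans_eq hzero) hlam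

end WeakSolution

section Growth

variable {Ω : Type*} [MeasurableSpace Ω] {μ : Measure Ω} {f r : Ω → ℝ} {g : ℝ → ℝ}

theorem integrableOn_of_lintegral_growth (hf : AEStronglyMeasurable f μ) (hf0 : ∀ x, 0 ≤ f x)
    (hgrowth : ∀ᶠ R in atTop,
      ∫⁻ x in {x | r x < R}, ENNReal.ofReal (f x) ∂μ ≤ ENNReal.ofReal (g R)) (R : ℝ) :
    IntegrableOn f {x | r x < R} μ := by
  obtain ⟨R', hle, hR⟩ := (hgrowth.and (eventually_ge_atTop R)).exists
  have hinteg : IntegrableOn f {x | r x < R'} μ := ⟨hf.restrict,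
    (hasFiniteIntegral_iff_ofReal (Eventually.of_forall hf0)).2
      (hle.trans_lt ENNReal.ofReal_lt_top)⟩
  exact hinteg.mono_set fun x (hx : r x < R) => hx.trans_le hR

theorem setIntegral_le_of_lintegral_growth (hf : AEStronglyMeasurable f μ) (hf0 : ∀ x, 0 ≤ f x)
    (hg : ∀ R, 0 ≤ g R) (hgrowth : ∀ᶠ R in atTop,
      ∫⁻ x in {x | r x < R}, ENNReal.ofReal (f x) ∂μ ≤ ENNReal.ofReal (g R)) :
    ∀ᶠ R in atTop, ∫ x in {x | r x < R}, f x ∂μ ≤ g R := by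
  filter_upwards [hgrowth] with R hR
  rw [integral_eq_lintegral_of_nonneg_ae (Eventually.of_forall hf0) hf.restrict]
  exact ENNReal.toReal_le_of_le_ofReal (hg R) hR

end Growth

section EnergyInequality

variable {m : ℕ} {M : Type*} [MetricSpace M] [SecondCountableTopology M] [ProperSpace M]
  [MeasurableSpace M] [BorelSpace M]
  [ChartedSpace (EuclideanSpace ℝ (Fin m)) M] [IsManifold (𝓡 m) ∞ M]
  [RiemannianBundle (fun x : M => TangentSpace (𝓡 m) x)]
  [IsContMDiffRiemannianBundle (𝓡 m) ∞ (EuclideanSpace ℝ (Fin m))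
    (fun x : M => TangentSpace (𝓡 m) x)]
  [IsRiemannianManifold (𝓡 m) M]

theorem IsWeakSolution.integral_energy_nonpos {p lam k c q R : ℝ}
    {A : (x : M) → ℝ → TangentSpace (𝓡 m) x → TangentSpace (𝓡 m) x} {u : M → ℝ}
    (hsol : IsWeakSolution p A (fun x => lam * (|u x| ^ (p - 2) * u x)) u)
    (hA : IsWeaklyCoercive p k A) (hp : 1 < p) (hlam : 0 < lam) (hk : 0 < k) (hc : 0 < c)
    (hq : p - 1 < q) (x₀ : M)
    (hinteg : IntegrableOn (fun x => |u x| ^ q) (Metric.ball x₀ R) (riemannianVolume m M)) :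
    ∫ x in Metric.ball x₀ R, |u x| ^ q * (cutoff p c R (dist x x₀) -
      absorptionConst p lam k c * (q - p + 1) ^ (1 - p) * Real.exp (-c * dist x x₀))
      ∂(riemannianVolume m M) ≤ 0 := by
  have hp0 : 0 < p := by linarith
  have hγ : 0 < 1 + (q - p) := by linarith
  obtain ⟨X, hX, htest⟩ := hsol
  have hinteg' : IntegrableOn (fun x => |u x| ^ p + |u x| ^ (p + (q - p))) (Metric.ball x₀ R)
      (riemannianVolume m M) := by
    rw [add_sub_cancel]
    exact ((hX.integrableOn_norm_rpow hp0 (isCompact_closedBall x₀ R)).mono_set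
      Metric.ball_subset_closedBall).add hinteg
  have henergy := integral_energy_nonpos_of_truncEnergy hp hc
    (absorptionConst_nonneg hp hlam hk hc) hγ hX.isWeakGradient.aemeasurable.restrict
    (measurable_id.dist measurable_const) (fun _ => dist_nonneg) hinteg' fun δ hδ =>
      integral_truncEnergy_nonpos hp hlam hk hc hγ hδ hA hX htest x₀ hinteg'
  rwa [add_sub_cancel, add_comm 1] at henergy

end EnergyInequality

end RiemannianLiouville

end

theorem mainTheorem3 {m : ℕ} {M : Type*} [MetricSpace M] [SecondCountableTopology M]
    [ConnectedSpace M] [MeasurableSpace M] [BorelSpace M]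
    [ChartedSpace (EuclideanSpace ℝ (Fin m)) M] [IsManifold (𝓡 m) ∞ M]
    [RiemannianBundle (fun x : M => TangentSpace (𝓡 m) x)]
    [IsContMDiffRiemannianBundle (𝓡 m) ∞ (EuclideanSpace ℝ (Fin m))
      (fun x : M => TangentSpace (𝓡 m) x)]
    [IsRiemannianManifold (𝓡 m) M] [CompleteSpace M]
    (p lam k : ℝ) (hp : 1 < p) (hlam : 0 < lam) (hk : 0 < k)
    (A : (x : M) → ℝ → TangentSpace (𝓡 m) x → TangentSpace (𝓡 m) x)
    (hA : RiemannianLiouville.IsWeaklyCoercive p k A)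
    (u : M → ℝ) (hu : RiemannianLiouville.MemSobolevLoc m p u)
    (hsol : RiemannianLiouville.IsWeakSolution p A (fun x => lam * (|u x| ^ (p - 2) * u x)) u)
    (x₀ : M) (q C : ℝ) (hq : p - 1 < q)
    (hC : C < p * (q - p + 1) ^ (1 / Real.conjExponent p) / (p - 1) ^ (1 / Real.conjExponent p) *
      (lam ^ (1 / p) / k))
    (hgrowth : ∀ᶠ R : ℝ in atTop,
      ∫⁻ x in Metric.ball x₀ R, ENNReal.ofReal (|u x| ^ q)
        ∂(RiemannianLiouville.riemannianVolume m M) ≤ ENNReal.ofReal (Real.exp (C * R))) :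
    u =ᵐ[RiemannianLiouville.riemannianVolume m M] 0 := by
  have := RiemannianLiouville.properSpace_of_completeSpace m M
  have : 0 < p := by linarith
  have hα : 0 < q - p + 1 := by linarith
  have hcrit : 0 < p * (q - p + 1) ^ (1 / Real.conjExponent p) /
      (p - 1) ^ (1 / Real.conjExponent p) * (lam ^ (1 / p) / k) := by
    have := sub_pos.2 hp
    positivity
  obtain ⟨c, hc, hcC⟩ := exists_between (max_lt hC hcrit)
  obtain ⟨hCc, hc0⟩ := max_lt_iff.1 hc
  obtain ⟨X, hX⟩ := hu
  have hmeas : AEStronglyMeasurable (fun x => |u x| ^ q)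
      (RiemannianLiouville.riemannianVolume m M) :=
    (hX.isWeakGradient.aemeasurable.abs.pow_const q).aestronglyMeasurable
  have hpow0 : ∀ x, 0 ≤ |u x| ^ q := fun x => Real.rpow_nonneg (abs_nonneg _) _
  have hinteg := RiemannianLiouville.integrableOn_of_lintegral_growth hmeas hpow0 hgrowth
  have hΘ := RiemannianLiouville.absorptionConst_nonneg hp hlam hk hc0
  have hzero := RiemannianLiouville.ae_eq_zero_of_energy hp hc0 hCc
    (mul_nonneg hΘ (Real.rpow_nonneg hα.le _))
    (RiemannianLiouville.absorptionConst_mul_rpow_lt_one hp hlam hk hc0 hα hcC) hpow0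
    (measurable_id.dist measurable_const) (fun _ => dist_nonneg) hinteg
    (RiemannianLiouville.setIntegral_le_of_lintegral_growth hmeas hpow0
      (fun _ => (Real.exp_pos _).le) hgrowth)
    fun R => hsol.integral_energy_nonpos hA hp hlam hk hc0 hq x₀ (hinteg R)
  filter_upwards [hzero] with x hx
  exact abs_eq_zero.1 ((Real.rpow_eq_zero (abs_nonneg _) (by linarith)).1 hx)
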